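/- **Setting.** Let $p,q\in\mathbb N$, $L>0$, let $Y\subset\mathbb R^q$ be nonempty, convex and compact with diameter $D_Y$, and let $g:\mathbb R^p\times Y\to\mathbb R$ be such that $g(x,\cdot)$ is concave for every $x$ and $g$ is $L$-smooth: for all $x,x'\in\mathbb R^p$, $y,y'\in Y$, $$\max\{\|\nabla_x g(x,y)-\nabla_x g(x',y')\|,\ \|\nabla_y g(x,y)-\nabla_y g(x',y')\|\}\le L(\|x-x'\|+\|y-y'\|).$$ Let $f(x)=\max_{y\in Y}g(x,y)$ satisfy $f\ge f^*>-\infty$. A point $x$ is an $\varepsilon$-FOSP of $f$ if the Moreau envelope $f_{1/(2L)}(x)=\min_{x'}\,[f(x')+L\|x-x'\|^2]$ is differentiable at $x$ with $\|\nabla f_{1/(2L)}(x)\|\le\varepsilon$. A first-order oracle call returns $(\nabla_xg(x,y),\nabla_yg(x,y))$ at one point; $P_Y$ is the Euclidean projection onto $Y$. **Prox-DIAG** (input $g,L,\varepsilon,x_0$, $y_0\in Y$). Put $\tilde\varepsilon=\varepsilon^2/(64L)$ and $\hat f(x;c)=f(x)+L\|x-c\|^2$. For $k=0,1,\dots$: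 use DIAG to find $x_{k+1}$ with $\hat f(x_{k+1};x_k)\le\min_x\hat f(x;x_k)+\tilde\varepsilon/4$; if $f(x_k)-\tfrac34\tilde\varepsilon\le\hat f(x_{k+1};x_k)$, return $x_k$. **Inner solver DIAG.** Apply the following to $h(x,y)=g(x,y)+L\|x-x_k\|^2$, which is $L'$-smooth with $L'=3L$ and $\sigma$-strongly convex in $x$ with $\sigma=L$, for $N=\lceil\sqrt{6L'^2D_Y^2/(\sigma\tilde\varepsilon/4)}\,\rceil$ iterations, starting from $(x_k,y_0)$. Put $\beta=2L'^2/\sigma$, $z_0=y_0$. For $j=0,\dots,N-1$: let $\tau_j=\frac2{j+2}$, $\eta_j=\frac{j+1}{2\beta}$, $w_j=(1-\tau_j)y_j+\tau_jz_j$; let $(u_{j+1},y_{j+1})$ be the output of Imp-STEP$(w_j)$ with accuracy $\varepsilon_{\rm step}=\frac{L'^2D_Y^2}{\sigma (j+1)^3(j+2)}$; let $z_{j+1}=P_Y(z_j+\eta_j\nabla_yh(u_{j+1},w_j))$. Output $x_{k+1}=\frac{2}{N(N+1)}\sum_{i=1}^N i\,u_i$. Imp-STEP$(w)$: put $\varepsilon_{\rm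 mp}=\frac{2\sigma}{5L'}\sqrt{2\varepsilon_{\rm step}/L'}$, $R=\max\{0,\lceil\log_2(2D_Y/\varepsilon_{\rm mp})\rceil\}$, $\varepsilon_{\rm agd}=\frac{\sigma\beta^2\varepsilon_{\rm mp}^2}{32L'^2}$, $v_0=w$; for $r=0,\dots,R$ run accelerated gradient descent (the linearly convergent version for $L'$-smooth, $\sigma$-strongly convex functions, one oracle call per iteration) on $h(\cdot,v_r)$ from $x_k$ up to its first iterate $\hat u_r$ with $h(\hat u_r,v_r)\le\min_uh(u,v_r)+\varepsilon_{\rm agd}$, and put $v_{r+1}=P_Y(w+\frac1\beta\nabla_yh(\hat u_r,w))$. Output $(\hat u_R,v_{R+1})$. **Theorem (convergence rate of Prox-DIAG).** Let $K=\left\lceil\frac{4^4L(f(x_0)-f^*)}{3\varepsilon^2}\right\rceil$. (1) For every $\varepsilon>0$, whatever points $x_{k+1}$ satisfying the above accuracy requirement are used, Prox-DIAG stops within $\max\{K,1\}$ outer iterations and outputs an $\varepsilon$-FOSP of $f$. If $D_Y>0$, every call of the above inner solver terminates with a point satisfying that requirement; hence Prox-DIAG with this inner solver terminates within $\max\{K,1\}$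 outer iterations and outputs an $\varepsilon$-FOSP. (2) There is an absolute constant $C$ such that for all $L,D,\Delta>0$ there is $\varepsilon_0>0$ such that, for every instance as above (in any dimensions) with $D_Y=D$ and $f(x_0)-f^*=\Delta$ and every $0<\varepsilon\le\varepsilon_0$, the total number of first-order oracle calls of Prox-DIAG with this inner solver is at most $$C\,\frac{L^2D_Y(f(x_0)-f^*)}{\varepsilon^3}\log^2\!\left(\frac1\varepsilon\right).$$ -/

import Mathlib

open scoped InnerProductSpace

noncomputable section

namespace Minimax

/-! ## Computations that count oracle calls -/

/-- A computation with result in `α`, given by its big-step semantics: `c a n` says that `c`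
terminates with the result `a` after exactly `n` calls to the first-order oracle.
A computation that does not terminate is related to no `a` and `n`. -/
def Comp (α : Type*) := α → ℕ → Prop

namespace Comp

variable {α β : Type*}

/-- Return `a`; no oracle call. -/
def ret (a : α) : Comp α := fun b n => b = a ∧ n = 0

/-- Sequential composition; the oracle calls add up. -/
def bind (c : Comp α) (k : α → Comp β) : Comp β :=
  fun b n => ∃ a m₁ m₂, c a m₁ ∧ k a b m₂ ∧ n = m₁ + m₂

/-- One oracle call. -/
def call (O : α → β) (a : α) : Comp β := fun b n => b = O a ∧ n = 1

/-- `for i = 0, …, N - 1 do s ← body i s`, starting from `s = a`. -/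
def forLoop (body : ℕ → α → Comp α) : ℕ → α → Comp α
  | 0, a => ret a
  | N + 1, a => (forLoop body N a).bind (body N)

/-- The unbounded loop: `body a` either asks to go on with a new state (`Sum.inl`) or to leave the
loop with a result (`Sum.inr`). -/
inductive Loop (body : α → Comp (α ⊕ β)) : α → β → ℕ → Prop
  | exit {a : α} {b : β} {m : ℕ} : body a (Sum.inr b) m → Loop body a b m
  | next {a a' : α} {b : β} {m n : ℕ} :
      body a (Sum.inl a') m → Loop body a' b n → Loop body a b (m + n)

/-- The unbounded loop as a computation. -/
def loop (body : α → Comp (α ⊕ β)) (a : α) : Comp β := fun b n => Loop body a b n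

end Comp

section Problem

variable {E F : Type*} [NormedAddCommGroup E] [InnerProductSpace ℝ E]
  [NormedAddCommGroup F] [InnerProductSpace ℝ F]

/-! ## The minimax problem -/

/-- `f(x) = max_{y ∈ Y} g(x, y)`. -/
def maxFun (g : E → F → ℝ) (Y : Set F) (x : E) : ℝ := ⨆ y : Y, g x y

/-- The standing assumptions: `Y` is a nonempty compact convex set, `g(x, ·)` is concave on `Y`, and
`g` is `L`-smooth on `E × Y`. The first-order oracle `G` returns
`G x y = (∇ₓ g(x, y), ∇_y g(x, y))`; the derivative in `y` is taken within `Y`, so that `g` only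
needs to be given on `E × Y`. -/
structure IsNonconvexConcave [CompleteSpace E] [CompleteSpace F]
    (g : E → F → ℝ) (G : E → F → E × F) (Y : Set F) (L : ℝ) : Prop where
  nonempty : Y.Nonempty
  isCompact : IsCompact Y
  convex : Convex ℝ Y
  concave : ∀ x, ConcaveOn ℝ Y (g x)
  gradX : ∀ x, ∀ y ∈ Y, HasGradientAt (fun x' => g x' y) (G x y).1 x
  gradY : ∀ x, ∀ y ∈ Y, HasGradientWithinAt (g x) (G x y).2 Y y
  smooth : ∀ x x', ∀ y ∈ Y, ∀ y' ∈ Y,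
    max ‖(G x y).1 - (G x' y').1‖ ‖(G x y).2 - (G x' y').2‖ ≤ L * (‖x - x'‖ + ‖y - y'‖)

/-- The Moreau envelope `f_μ(x) = min_{x'} f(x') + ‖x - x'‖² / (2 μ)`. -/
def moreauEnvelope (f : E → ℝ) (μ : ℝ) (x : E) : ℝ :=
  ⨅ x' : E, (f x' + 1 / (2 * μ) * ‖x - x'‖ ^ 2)

/-- `x` is an `ε`-first order stationary point of the `L`-weakly convex function `f`: the Moreau
envelope of `f` with parameter `1 / (2 L)` has at `x` a gradient, of norm at most `ε`. -/
def IsFOSP [CompleteSpace E] (f : E → ℝ) (L ε : ℝ) (x : E) : Prop :=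
  ∃ v : E, HasGradientAt (moreauEnvelope f (1 / (2 * L))) v x ∧ ‖v‖ ≤ ε

/-- Euclidean projection onto `Y` (a point of `Y` closest to `v`; unique for closed convex
nonempty `Y`). -/
def proj (Y : Set F) (v : F) : F :=
  Classical.epsilon fun u => u ∈ Y ∧ ∀ y ∈ Y, ‖v - u‖ ≤ ‖v - y‖

/-! ## The algorithms -/

open Classical in
/-- Accelerated gradient descent for an `L`-smooth and `σ`-strongly convex function `φ` with
gradient `dφ`, started at `x₀` and stopped at the first iterate whose value is within `tol` of the
minimum. The state is the pair `(u, v)` of the iterate and the auxiliary point; every iteration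
makes one oracle call. -/
def agd (φ : E → ℝ) (dφ : E → E) (L σ : ℝ) (x₀ : E) (tol : ℝ) : Comp E :=
  Comp.loop
    (fun s : E × E =>
      if φ s.1 ≤ (⨅ x : E, φ x) + tol then
        Comp.ret (Sum.inr s.1)
      else
        let θ : ℝ := Real.sqrt (L / σ)
        let τ : ℝ := 1 / (θ + 1)
        let w : E := (1 - τ) • s.1 + τ • s.2
        (Comp.call dφ w).bind fun d =>
          Comp.ret (Sum.inl
            (w - (1 / L) • d, (1 - 1 / θ) • s.2 + (1 / θ) • (w - (1 / σ) • d))))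
    (x₀, x₀)

/-- The subroutine Imp-STEP: approximately find `(x, y)` such that `x` minimizes `g(·, y)` and
`y = P_Y (w + ∇_y g(x, w) / β)`. The state before round `r` is `(x̂_{r-1}, y_r)`. -/
def impStep (g : E → F → ℝ) (G : E → F → E × F) (Y : Set F) (L σ : ℝ) (x₀ : E) (w : F)
    (β εstep : ℝ) : Comp (E × F) :=
  let εmp : ℝ := 2 * σ / (5 * L) * Real.sqrt (2 * εstep / L)
  let R : ℕ := ⌈Real.logb 2 (2 * Metric.diam Y / εmp)⌉₊
  let εagd : ℝ := σ * β ^ 2 * εmp ^ 2 / (32 * L ^ 2)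
  Comp.forLoop
    (fun _ s =>
      (agd (fun x => g x s.2) (fun x => (G x s.2).1) L σ x₀ εagd).bind fun x =>
        (Comp.call (fun x => (G x w).2) x).bind fun d =>
          Comp.ret (x, proj Y (w + (1 / β) • d)))
    (R + 1) (x₀, w)

/-- DIAG (dual implicit accelerated gradient) with `K` iterations and step accuracies
`εstep 1, …, εstep K`, for an `L`-smooth `g` that is `σ`-strongly convex in `x` and concave in `y`;
it returns `(x̄_K, y_K)`. The state before iteration `k` is `(y_k, z_k, ∑_{i ≤ k} i x_i)`. -/
def diag (g : E → F → ℝ) (G : E → F → E × F) (Y : Set F) (L σ : ℝ) (x₀ : E) (y₀ : F)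
    (K : ℕ) (εstep : ℕ → ℝ) : Comp (E × F) :=
  let β : ℝ := 2 * L ^ 2 / σ
  (Comp.forLoop
    (fun k (s : F × F × E) =>
      let τ : ℝ := 2 / ((k : ℝ) + 2)
      let η : ℝ := ((k : ℝ) + 1) / (2 * β)
      let w : F := (1 - τ) • s.1 + τ • s.2.1
      (impStep g G Y L σ x₀ w β (εstep (k + 1))).bind fun r =>
        (Comp.call (fun x => (G x w).2) r.1).bind fun d =>
          Comp.ret (r.2, proj Y (s.2.1 + η • d), s.2.2 + ((k : ℝ) + 1) • r.1))
    K (y₀, y₀, 0)).bind fun s =>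
      Comp.ret ((2 / ((K : ℝ) * ((K : ℝ) + 1))) • s.2.2, s.1)

/-- `f̂(x; c) = max_{y ∈ Y} g(x, y) + L ‖x - c‖²`. -/
def proxModel (g : E → F → ℝ) (Y : Set F) (L : ℝ) (c x : E) : ℝ :=
  maxFun g Y x + L * ‖x - c‖ ^ 2

/-- The inner accuracy parameter `ε̃ = ε² / (64 L)`. -/
def tildeEps (L ε : ℝ) : ℝ := ε ^ 2 / (64 * L)

/-- The accuracy required of the inner solution `x'` at the prox center `c`. -/
def InnerAccurate (g : E → F → ℝ) (Y : Set F) (L ε : ℝ) (c x' : E) : Prop :=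
  ∀ x, proxModel g Y L c x' ≤ proxModel g Y L c x + tildeEps L ε / 4

/-- The stopping test of Prox-DIAG at the current point `c` with inner solution `x'`. -/
def ShouldStop (g : E → F → ℝ) (Y : Set F) (L ε : ℝ) (c x' : E) : Prop :=
  maxFun g Y c - 3 * tildeEps L ε / 4 ≤ proxModel g Y L c x'

/-- The inner solver: DIAG, started at `(c, y₀)`, for `g(x, y) + L ‖x - c‖²`, which is
`3L`-smooth and `L`-strongly convex in `x`. With `L' = 3L`, `σ = L` and `D` the diameter of `Y`,
the step accuracies are `L'² D² / (σ k³ (k + 1))` and the number of iterations is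
`K = ⌈√(6 L'² D² / (σ δ))⌉` for `δ = ε̃ / 4`. One oracle call of the regularized function is
one oracle call of `g`. -/
def innerSolve (g : E → F → ℝ) (G : E → F → E × F) (Y : Set F) (L ε : ℝ) (y₀ : F) (c : E) :
    Comp E :=
  let L' : ℝ := 3 * L
  let σ : ℝ := L
  let D : ℝ := Metric.diam Y
  let δ : ℝ := tildeEps L ε / 4
  (diag (fun x y => g x y + L * ‖x - c‖ ^ 2)
    (fun x y => ((G x y).1 + (2 * L) • (x - c), (G x y).2)) Y L' σ c y₀
    ⌈Real.sqrt (6 * L' ^ 2 * D ^ 2 / (σ * δ))⌉₊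
    (fun k => L' ^ 2 * D ^ 2 / (σ * (k : ℝ) ^ 3 * ((k : ℝ) + 1)))).bind fun r =>
      Comp.ret r.1

open Classical in
/-- Prox-DIAG. The state is `(x_k, k)`; the result `(x_k, k)` says that `x_k` is returned in the
iteration with index `k`, that is, after `k + 1` outer iterations. -/
def proxDiag (g : E → F → ℝ) (G : E → F → E × F) (Y : Set F) (L ε : ℝ) (x₀ : E) (y₀ : F) :
    Comp (E × ℕ) :=
  Comp.loop
    (fun s : E × ℕ =>
      (innerSolve g G Y L ε y₀ s.1).bind fun x' =>
        if ShouldStop g Y L ε s.1 x' then Comp.ret (Sum.inr s)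
        else Comp.ret (Sum.inl (x', s.2 + 1)))
    (x₀, 0)

/-- The bound `⌈4⁴ L (f(x₀) - f*) / (3 ε²)⌉` on the number of outer steps. -/
def outerSteps (L ε gap : ℝ) : ℕ := ⌈4 ^ 4 * L * gap / (3 * ε ^ 2)⌉₊

end Problem

end Minimax

end

open Minimax

open scoped InnerProductSpace

namespace Minimax

theorem le_of_forall_le_add_mul {a b c : ℝ} (hc : 0 ≤ c)
    (h : ∀ t : ℝ, 0 < t → t < 1 → a ≤ b + t * c) : a ≤ b := by
  refine le_of_forall_pos_le_add fun e he => ?_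
  have hpos : 0 < min (1 / 2) (e / (c + 1)) := by positivity
  refine (h _ hpos ((min_le_left _ _).trans_lt (by norm_num))).trans ?_
  have h1 : min (1 / 2) (e / (c + 1)) * c ≤ e / (c + 1) * c := by gcongr; exact min_le_right _ _
  have h2 : e / (c + 1) * c ≤ e := by
    rw [div_mul_eq_mul_div, div_le_iff₀ (by positivity)]; nlinarith
  linarith

section Smooth

variable {V : Type*} [NormedAddCommGroup V] [InnerProductSpace ℝ V]

/-- The descent lemma on a convex set. -/
theorem abs_sub_sub_inner_le [CompleteSpace V] {S : Set V} (hS : Convex ℝ S) {φ : V → ℝ}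
    {d : V → V} {L : ℝ}
    (hφ : ∀ x ∈ S, HasGradientWithinAt φ (d x) S x)
    (hd : ∀ x ∈ S, ∀ y ∈ S, ‖d x - d y‖ ≤ L * ‖x - y‖) {x y : V} (hx : x ∈ S) (hy : y ∈ S) :
    |φ y - φ x - ⟪d x, y - x⟫_ℝ| ≤ L / 2 * ‖y - x‖ ^ 2 := by
  let γ : ℝ → V := fun t => x + t • (y - x)
  have hγ : ∀ t ∈ Set.Icc (0 : ℝ) 1, γ t ∈ S := fun t ht =>
    hS.add_smul_sub_mem hx hy ht
  have hγd : ∀ t, HasDerivAt γ (y - x) t := fun t => by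
    have h := ((hasDerivAt_id' t).smul_const (y - x)).const_add x
    rwa [one_smul] at h
  have hder : ∀ t ∈ Set.Icc (0 : ℝ) 1, HasDerivWithinAt
      (fun t => φ (γ t) - φ x - t * ⟪d x, y - x⟫_ℝ)
      (⟪d (γ t), y - x⟫_ℝ - ⟪d x, y - x⟫_ℝ) (Set.Icc 0 1) t := by
    intro t ht
    have h1 := (hφ _ (hγ t ht)).hasFDerivWithinAt.comp_hasDerivWithinAt t
      (hγd t).hasDerivWithinAt hγ
    simp only [InnerProductSpace.toDual_apply_apply] at h1
    have h2 := ((hasDerivAt_id' t).hasDerivWithinAt (s := Set.Icc 0 1) |>.mul_const ⟪d x, y - x⟫_ℝ)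
    rw [one_mul] at h2
    exact (h1.sub_const (φ x)).sub h2
  have key := image_norm_le_of_norm_deriv_right_le_deriv_boundary
    (f := fun t => φ (γ t) - φ x - t * ⟪d x, y - x⟫_ℝ) (a := 0) (b := 1)
    (f' := fun t => ⟪d (γ t), y - x⟫_ℝ - ⟪d x, y - x⟫_ℝ)
    (B := fun t => L / 2 * ‖y - x‖ ^ 2 * t ^ 2) (B' := fun t => L * ‖y - x‖ ^ 2 * t)
    (fun t ht => (hder t ht).continuousWithinAt)
    (fun t ht => (hder t ⟨ht.1, ht.2.le⟩).mono_of_mem_nhdsWithin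
      (Icc_mem_nhdsGE_of_mem ht))
    (by simp [γ])
    (fun t => by
      refine ((hasDerivAt_pow 2 t).const_mul (L / 2 * ‖y - x‖ ^ 2)).congr_deriv ?_
      norm_num; ring)
    (fun t ht => by
      have h1 := hd _ (hγ t ⟨ht.1, ht.2.le⟩) _ hx
      have h2 : ‖γ t - x‖ = t * ‖y - x‖ := by
        simp [γ, norm_smul, abs_of_nonneg ht.1]
      rw [← inner_sub_left]
      calc _ ≤ ‖d (γ t) - d x‖ * ‖y - x‖ := norm_inner_le_norm _ _
        _ ≤ (L * (t * ‖y - x‖)) * ‖y - x‖ := by rw [← h2]; gcongr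
        _ = _ := by ring)
    (Set.right_mem_Icc.2 zero_le_one)
  simpa [γ, Real.norm_eq_abs] using key

theorem le_add_inner_of_concaveOn {S : Set V} {φ : V → ℝ} (hφ : ConcaveOn ℝ S φ) {d x y : V}
    {C : ℝ} (hC : 0 ≤ C) (hx : x ∈ S) (hy : y ∈ S)
    (h : ∀ y ∈ S, φ y ≤ φ x + ⟪d, y - x⟫_ℝ + C * ‖y - x‖ ^ 2) :
    φ y ≤ φ x + ⟪d, y - x⟫_ℝ := by
  refine le_of_forall_le_add_mul (c := C * ‖y - x‖ ^ 2) (by positivity) fun t ht0 ht1 => ?_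
  have h1 := hφ.2 hx hy (sub_nonneg.2 ht1.le) ht0.le (by ring)
  have h2 := h _ (hφ.1 hx hy (sub_nonneg.2 ht1.le) ht0.le (by ring))
  have h3 : (1 - t) • x + t • y - x = t • (y - x) := by module
  rw [h3, inner_smul_right, norm_smul, Real.norm_of_nonneg ht0.le] at h2
  simp only [smul_eq_mul] at h1
  have : t * φ y ≤ t * (φ x + ⟪d, y - x⟫_ℝ + t * (C * ‖y - x‖ ^ 2)) := by nlinarith
  exact le_of_mul_le_mul_left this ht0

end Smooth

section Projection

theorem proj_spec {V : Type*} [NormedAddCommGroup V] {Y : Set V} (hne : Y.Nonempty)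
    (hc : IsCompact Y) (v : V) :
    proj Y v ∈ Y ∧ ∀ y ∈ Y, ‖v - proj Y v‖ ≤ ‖v - y‖ := by
  have : ∃ u, u ∈ Y ∧ ∀ y ∈ Y, ‖v - u‖ ≤ ‖v - y‖ := by
    obtain ⟨u, hu, h⟩ := hc.exists_isMinOn hne
      (f := fun u => ‖v - u‖) (by fun_prop)
    exact ⟨u, hu, fun y hy => h hy⟩
  exact Classical.epsilon_spec this

theorem proj_mem {V : Type*} [NormedAddCommGroup V] {Y : Set V} (hne : Y.Nonempty)
    (hc : IsCompact Y) (v : V) : proj Y v ∈ Y :=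
  (proj_spec hne hc v).1

variable {V : Type*} [NormedAddCommGroup V] [InnerProductSpace ℝ V] {Y : Set V}

theorem inner_sub_proj_le (hne : Y.Nonempty) (hc : IsCompact Y) (hY : Convex ℝ Y) (v : V) {y : V}
    (hy : y ∈ Y) : ⟪v - proj Y v, y - proj Y v⟫_ℝ ≤ 0 := by
  obtain ⟨hu, h⟩ := proj_spec hne hc v
  refine (norm_eq_iInf_iff_real_inner_le_zero hY hu).1 ?_ y hy
  have : Nonempty Y := hne.to_subtype
  exact le_antisymm (le_ciInf fun w => h w w.2)
    (ciInf_le ⟨0, by rintro _ ⟨w, rfl⟩; exact norm_nonneg _⟩ (⟨_, hu⟩ : Y))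

theorem norm_proj_sub_proj_le (hne : Y.Nonempty) (hc : IsCompact Y) (hY : Convex ℝ Y) (a b : V) :
    ‖proj Y a - proj Y b‖ ≤ ‖a - b‖ := by
  have h1 := inner_sub_proj_le hne hc hY a (proj_mem hne hc b)
  have h2 := inner_sub_proj_le hne hc hY b (proj_mem hne hc a)
  set u := proj Y a
  set v := proj Y b
  have h3 : ‖u - v‖ * ‖u - v‖ ≤ ‖a - b‖ * ‖u - v‖ := by
    calc ‖u - v‖ * ‖u - v‖ = ⟪u - v, u - v⟫_ℝ := (real_inner_self_eq_norm_mul_norm _).symm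
      _ = ⟪a - b, u - v⟫_ℝ + ⟪a - u, v - u⟫_ℝ + ⟪b - v, u - v⟫_ℝ := by
        simp only [inner_sub_left, inner_sub_right]; ring
      _ ≤ ⟪a - b, u - v⟫_ℝ := by linarith
      _ ≤ _ := real_inner_le_norm _ _
  rcases (norm_nonneg (u - v)).eq_or_lt with h | h
  · rw [← h]; exact norm_nonneg _
  · exact le_of_mul_le_mul_right h3 h

/-- A projected gradient ascent step maximizes the linear model minus the proximal term. -/
theorem inner_sub_le_of_proj (hne : Y.Nonempty) (hc : IsCompact Y) (hY : Convex ℝ Y) {η : ℝ}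
    (hη : 0 < η) (z d : V) {y : V} (hy : y ∈ Y) :
    ⟪d, y - proj Y (z + η • d)⟫_ℝ ≤ 1 / (2 * η) *
      (‖y - z‖ ^ 2 - ‖proj Y (z + η • d) - z‖ ^ 2 - ‖y - proj Y (z + η • d)‖ ^ 2) := by
  have h := inner_sub_proj_le hne hc hY (z + η • d) hy
  set p := proj Y (z + η • d)
  have h1 : ‖y - z‖ ^ 2 = ‖y - p‖ ^ 2 + 2 * ⟪y - p, p - z⟫_ℝ + ‖p - z‖ ^ 2 := by
    rw [← norm_add_sq_real]; congr 2; abel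
  have h2 : ⟪z + η • d - p, y - p⟫_ℝ = η * ⟪d, y - p⟫_ℝ - ⟪y - p, p - z⟫_ℝ := by
    rw [show z + η • d - p = η • d - (p - z) by abel, inner_sub_left, inner_smul_left,
      real_inner_comm (y - p) (p - z)]
    simp
  rw [h1, show ⟪d, y - p⟫_ℝ = 1 / (2 * η) * (2 * (η * ⟪d, y - p⟫_ℝ)) by field_simp]
  have : 0 < 1 / (2 * η) := by positivity
  gcongr
  linarith

end Projection

namespace Comp

variable {α β : Type*}

theorem forLoop_invariant {body : ℕ → α → Comp α} {N : ℕ} {a : α} (P : ℕ → α → Prop) {B : ℕ}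
    (h0 : P 0 a)
    (hstep : ∀ i < N, ∀ s s' m, P i s → body i s s' m → P (i + 1) s' ∧ m ≤ B) {s : α} {n : ℕ}
    (h : forLoop body N a s n) : P N s ∧ n ≤ N * B := by
  induction N generalizing s n with
  | zero => obtain ⟨rfl, rfl⟩ := h; exact ⟨h0, by simp⟩
  | succ N ih =>
    obtain ⟨s', m₁, m₂, h1, h2, rfl⟩ := h
    obtain ⟨hP, hm⟩ := ih (fun i hi => hstep i (hi.trans N.lt_succ_self)) h1
    obtain ⟨hP', hm'⟩ := hstep N N.lt_succ_self _ _ _ hP h2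
    exact ⟨hP', by rw [add_mul, one_mul]; exact add_le_add hm hm'⟩

theorem exists_forLoop {body : ℕ → α → Comp α} {N : ℕ} {a : α} (P : ℕ → α → Prop)
    (h0 : P 0 a) (hstep : ∀ i < N, ∀ s, P i s → ∃ s' m, body i s s' m)
    (hinv : ∀ i < N, ∀ s s' m, P i s → body i s s' m → P (i + 1) s') :
    ∃ s n, forLoop body N a s n ∧ P N s := by
  induction N with
  | zero => exact ⟨a, 0, ⟨rfl, rfl⟩, h0⟩
  | succ N ih =>
    obtain ⟨s, n, hs, hP⟩ := ih (fun i hi => hstep i (hi.trans N.lt_succ_self))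
      (fun i hi => hinv i (hi.trans N.lt_succ_self))
    obtain ⟨s', m, hs'⟩ := hstep N N.lt_succ_self s hP
    exact ⟨s', n + m, ⟨s, n, m, hs, hs', rfl⟩, hinv N N.lt_succ_self _ _ _ hP hs'⟩

end Comp

namespace Comp

variable {α β ι : Type*} {body : α → Comp (α ⊕ β)}

theorem Loop.of_invariant {P : ι → α → Prop} {Q : ι → β → ℕ → Prop}
    (hexit : ∀ T s b m, P T s → body s (Sum.inr b) m → Q T b m)
    (hnext : ∀ T s s' m, P T s → body s (Sum.inl s') m →
      ∃ T', P T' s' ∧ ∀ b n, Q T' b n → Q T b (m + n))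
    {s : α} {b : β} {n : ℕ} (h : Loop body s b n) {T : ι} (hP : P T s) : Q T b n := by
  induction h generalizing T with
  | exit h => exact hexit _ _ _ _ hP h
  | next h _ ih =>
    obtain ⟨T', hP', hT'⟩ := hnext _ _ _ _ hP h
    exact hT' _ _ (ih hP')

theorem exists_loop {P : ℕ → α → Prop}
    (hstep : ∀ T s, P T s → (∃ b m, body s (Sum.inr b) m) ∨
      ∃ s' m, ∃ T' < T, body s (Sum.inl s') m ∧ P T' s') {T : ℕ} {s : α} (h : P T s) :
    ∃ b n, Loop body s b n := by
  induction T using Nat.strong_induction_on generalizing s with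
  | _ T ih =>
    rcases hstep T s h with ⟨b, m, hb⟩ | ⟨s', m, T', hT', hs', hP⟩
    · exact ⟨b, m, .exit hb⟩
    · obtain ⟨b, n, hb⟩ := ih T' hT' hP
      exact ⟨b, m + n, .next hs' hb⟩

end Comp

theorem iInf_eq_of_forall_le {α : Type*} {φ : α → ℝ} {xs : α} (hmin : ∀ x, φ xs ≤ φ x) :
    ⨅ x, φ x = φ xs :=
  le_antisymm (ciInf_le ⟨φ xs, by rintro _ ⟨x, rfl⟩; exact hmin x⟩ xs)
    (have : Nonempty α := ⟨xs⟩; le_ciInf hmin)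

section Agd

variable {E : Type*} [NormedAddCommGroup E] [InnerProductSpace ℝ E]
  {φ : E → ℝ} {dφ : E → E} {L σ : ℝ} {xs : E}

/-- One step of accelerated gradient descent contracts the potential
`φ u - φ xs + σ / 2 * ‖v - xs‖ ^ 2` by the factor `1 - √(σ / L)`. -/
theorem agd_step_le (hσ : 0 < σ) (hσL : σ ≤ L)
    (hlow : ∀ x x', φ x + ⟪dφ x, x' - x⟫_ℝ + σ / 2 * ‖x' - x‖ ^ 2 ≤ φ x')
    (hupp : ∀ x x', φ x' ≤ φ x + ⟪dφ x, x' - x⟫_ℝ + L / 2 * ‖x' - x‖ ^ 2)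
    {θ : ℝ} (hθ : θ = Real.sqrt (L / σ)) {u v w d : E}
    (hw : w = (1 - 1 / (θ + 1)) • u + (1 / (θ + 1)) • v) (hd : d = dφ w) :
    φ (w - (1 / L) • d) - φ xs
      + σ / 2 * ‖(1 - 1 / θ) • v + (1 / θ) • (w - (1 / σ) • d) - xs‖ ^ 2
      ≤ (1 - 1 / θ) * (φ u - φ xs + σ / 2 * ‖v - xs‖ ^ 2) := by
  have hL : 0 < L := hσ.trans_le hσL
  have hθ1 : 1 ≤ θ := by
    rw [hθ]; exact Real.one_le_sqrt.2 ((one_le_div hσ).2 hσL)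
  have hθ0 : 0 < θ := one_pos.trans_le hθ1
  have hθ2 : θ ^ 2 = L / σ := by rw [hθ]; exact Real.sq_sqrt (by positivity)
  have e1 := hupp w (w - (1 / L) • d)
  have e2 := hlow w u
  have e3 := hlow w xs
  rw [← hd] at e1 e2 e3
  set a : ℝ := 1 / θ with ha
  have ha0 : 0 < a := by positivity
  have ha1 : a ≤ 1 := by rw [ha, div_le_one hθ0]; exact hθ1
  have haL : a ^ 2 / σ = 1 / L := by
    rw [ha, div_pow, hθ2]; field_simp
  have e1' : φ (w - (1 / L) • d) ≤ φ w - 1 / (2 * L) * ‖d‖ ^ 2 := by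
    rw [show w - (1 / L) • d - w = (-(1 / L)) • d by module, inner_smul_right, norm_smul,
      real_inner_self_eq_norm_sq, mul_pow, Real.norm_eq_abs, sq_abs] at e1
    have : -(1 / L) * ‖d‖ ^ 2 + L / 2 * ((-(1 / L)) ^ 2 * ‖d‖ ^ 2) = -(1 / (2 * L) * ‖d‖ ^ 2) := by
      field_simp; ring
    linarith
  have e2' : φ w + ⟪d, u - w⟫_ℝ ≤ φ u := by
    have : 0 ≤ σ / 2 * ‖u - w‖ ^ 2 := by positivity
    linarith
  set p := v - xs with hp
  set r := w - xs with hr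
  have e3' : φ w - φ xs ≤ ⟪d, r⟫_ℝ - σ / 2 * ‖r‖ ^ 2 := by
    rw [← neg_sub w xs, ← hr, inner_neg_right, norm_neg] at e3
    linarith
  have hsplit : (1 - a) • v + a • (w - (1 / σ) • d) - xs = ((1 - a) • p + a • r) - (a / σ) • d := by
    rw [hp, hr, div_eq_mul_one_div a σ]; module
  have hconv : ‖(1 - a) • p + a • r‖ ^ 2 ≤ (1 - a) * ‖p‖ ^ 2 + a * ‖r‖ ^ 2 := by
    have h1 : ‖(1 - a) • p + a • r‖ ^ 2
        = (1 - a) * ‖p‖ ^ 2 + a * ‖r‖ ^ 2 - a * (1 - a) * ‖p - r‖ ^ 2 := by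
      rw [norm_add_sq_real, norm_sub_sq_real p r, norm_smul, norm_smul, inner_smul_left,
        inner_smul_right, mul_pow, mul_pow, Real.norm_eq_abs, Real.norm_eq_abs, sq_abs, sq_abs]
      simp only [conj_trivial]; ring
    have : 0 ≤ a * (1 - a) * ‖p - r‖ ^ 2 := by
      have := sub_nonneg.2 ha1; positivity
    linarith
  have hnorm : σ / 2 * ‖((1 - a) • p + a • r) - (a / σ) • d‖ ^ 2
      = σ / 2 * ‖(1 - a) • p + a • r‖ ^ 2 - a * ((1 - a) * ⟪d, p⟫_ℝ + a * ⟪d, r⟫_ℝ)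
        + 1 / (2 * L) * ‖d‖ ^ 2 := by
    have h1 : 1 / (2 * L) = a ^ 2 / (2 * σ) := by
      rw [show a ^ 2 / (2 * σ) = a ^ 2 / σ / 2 by ring, haL]; ring
    rw [norm_sub_sq_real, h1, norm_smul, inner_smul_right, mul_pow, Real.norm_eq_abs, sq_abs,
      real_inner_comm, inner_add_right, inner_smul_right, inner_smul_right]
    field_simp
  have hpt : ⟪d, u - w⟫_ℝ = a * (⟪d, r⟫_ℝ - ⟪d, p⟫_ℝ) := by
    rw [← inner_sub_right, ← inner_smul_right]
    congr 1
    rw [hp, hr, show w - xs - (v - xs) = w - v by abel, hw, ha]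
    have : u - ((1 - 1 / (θ + 1)) • u + (1 / (θ + 1)) • v) = (1 / (θ + 1)) • (u - v) := by module
    rw [this, show (1 - 1 / (θ + 1)) • u + (1 / (θ + 1)) • v - v = (1 - 1 / (θ + 1)) • (u - v) by
      module, smul_smul]
    congr 1
    field_simp
    ring
  rw [hsplit, hnorm]
  have k1 := mul_le_mul_of_nonneg_left e2' (sub_nonneg.2 ha1)
  have k2 := mul_le_mul_of_nonneg_left e3' ha0.le
  have k3 := mul_le_mul_of_nonneg_left hconv (half_pos hσ).le
  rw [hpt] at k1
  linarith

theorem agd_spec (hσ : 0 < σ) (hσL : σ ≤ L) (hmin : ∀ x, φ xs ≤ φ x)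
    (hlow : ∀ x x', φ x + ⟪dφ x, x' - x⟫_ℝ + σ / 2 * ‖x' - x‖ ^ 2 ≤ φ x')
    (hupp : ∀ x x', φ x' ≤ φ x + ⟪dφ x, x' - x⟫_ℝ + L / 2 * ‖x' - x‖ ^ 2)
    {x₀ : E} {tol : ℝ} {T : ℕ}
    (hT : (1 - 1 / Real.sqrt (L / σ)) ^ T * (φ x₀ - φ xs + σ / 2 * ‖x₀ - xs‖ ^ 2) ≤ tol) :
    (∃ x n, agd φ dφ L σ x₀ tol x n) ∧
      ∀ x n, agd φ dφ L σ x₀ tol x n → φ x ≤ φ xs + tol ∧ n ≤ T := by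
  set θ := Real.sqrt (L / σ) with hθ
  have hρ : 0 ≤ 1 - 1 / θ := by
    have : 1 ≤ θ := Real.one_le_sqrt.2 ((one_le_div hσ).2 hσL)
    rw [sub_nonneg, div_le_one (by positivity)]; exact this
  let Φ : E × E → ℝ := fun s => φ s.1 - φ xs + σ / 2 * ‖s.2 - xs‖ ^ 2
  let P : ℕ → E × E → Prop := fun T s => (1 - 1 / θ) ^ T * Φ s ≤ tol
  have hterm : ∀ s, P 0 s → φ s.1 ≤ (⨅ x, φ x) + tol := by
    intro s hs
    simp only [P, Φ, pow_zero, one_mul] at hs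
    rw [iInf_eq_of_forall_le hmin]
    have : 0 ≤ σ / 2 * ‖s.2 - xs‖ ^ 2 := by positivity
    linarith
  have hcontr : ∀ T (s s' : E × E), P (T + 1) s → Φ s' ≤ (1 - 1 / θ) * Φ s → P T s' := by
    intro T s s' hs h
    refine le_trans ?_ hs
    rw [pow_succ, mul_assoc]
    gcongr
  constructor
  · refine Comp.exists_loop (P := P) ?_ hT
    intro T s hs
    by_cases h : φ s.1 ≤ (⨅ x : E, φ x) + tol
    · exact .inl ⟨s.1, 0, by rw [if_pos h]; exact ⟨rfl, rfl⟩⟩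
    · refine .inr ?_
      obtain _ | T := T
      · exact absurd (hterm s hs) h
      · refine ⟨_, 1, T, T.lt_succ_self, by
          rw [if_neg h]; exact ⟨_, 1, 0, ⟨rfl, rfl⟩, ⟨rfl, rfl⟩, rfl⟩, hcontr T s _ hs ?_⟩
        exact agd_step_le hσ hσL hlow hupp hθ rfl rfl
  · intro x n h
    refine Comp.Loop.of_invariant (P := P) (Q := fun T x n => φ x ≤ φ xs + tol ∧ n ≤ T)
      ?_ ?_ h hT
    · intro T s b m hs hb
      split_ifs at hb with hc
      · obtain ⟨hb, rfl⟩ := hb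
        obtain rfl := Sum.inr_injective hb
        exact ⟨by rwa [iInf_eq_of_forall_le hmin] at hc, Nat.zero_le _⟩
      · obtain ⟨_, _, _, _, ⟨hb, _⟩, _⟩ := hb
        cases hb
    · intro T s s' m hs hb
      split_ifs at hb with hc
      · obtain ⟨hb, rfl⟩ := hb
        cases hb
      · obtain ⟨d, m₁, m₂, ⟨rfl, rfl⟩, ⟨hb, rfl⟩, rfl⟩ := hb
        obtain rfl := Sum.inl_injective hb
        obtain _ | T := T
        · exact absurd (hterm s hs) hc
        · exact ⟨T, hcontr T s _ hs (agd_step_le hσ hσL hlow hupp hθ rfl rfl),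
            fun b n h => ⟨h.1, by omega⟩⟩

end Agd

theorem exists_forall_le_of_lowerSemicontinuous {V : Type*} [NormedAddCommGroup V]
    [ProperSpace V] {φ : V → ℝ} (hφ : LowerSemicontinuous φ) {x₀ : V} {ρ : ℝ}
    (hρ : ∀ x, ρ < ‖x - x₀‖ → φ x₀ ≤ φ x) : ∃ xs, ∀ x, φ xs ≤ φ x := by
  have hx₀ : x₀ ∈ Metric.closedBall x₀ (max ρ 0) :=
    Metric.mem_closedBall_self (le_max_right _ _)
  obtain ⟨xs, -, h⟩ := (hφ.lowerSemicontinuousOn _).exists_isMinOn ⟨x₀, hx₀⟩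
    (isCompact_closedBall x₀ (max ρ 0))
  refine ⟨xs, fun x => ?_⟩
  by_cases hx : x ∈ Metric.closedBall x₀ (max ρ 0)
  · exact h hx
  · refine (h hx₀).trans (hρ x ?_)
    rw [Metric.mem_closedBall, not_le, dist_eq_norm] at hx
    exact (le_max_left _ _).trans_lt hx

/-- `h` is `L`-smooth on `E × Y`, `σ`-strongly convex in the first variable, and concave in the
second, with gradient `H`; stated by the first-order inequalities. -/
structure IsStronglyConvexConcave {E F : Type*} [NormedAddCommGroup E] [InnerProductSpace ℝ E]
    [NormedAddCommGroup F] [InnerProductSpace ℝ F]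
    (h : E → F → ℝ) (H : E → F → E × F) (Y : Set F) (L σ : ℝ) : Prop where
  nonempty : Y.Nonempty
  isCompact : IsCompact Y
  convex : Convex ℝ Y
  pos : 0 < σ
  le : σ ≤ L
  cont : ∀ y ∈ Y, Continuous fun x => h x y
  lowerX : ∀ y ∈ Y, ∀ x x', h x y + ⟪(H x y).1, x' - x⟫_ℝ + σ / 2 * ‖x' - x‖ ^ 2 ≤ h x' y
  upperX : ∀ y ∈ Y, ∀ x x', h x' y ≤ h x y + ⟪(H x y).1, x' - x⟫_ℝ + L / 2 * ‖x' - x‖ ^ 2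
  lowerY : ∀ x, ∀ y ∈ Y, ∀ y' ∈ Y,
    h x y + ⟪(H x y).2, y' - y⟫_ℝ - L / 2 * ‖y' - y‖ ^ 2 ≤ h x y'
  upperY : ∀ x, ∀ y ∈ Y, ∀ y' ∈ Y, h x y' ≤ h x y + ⟪(H x y).2, y' - y⟫_ℝ
  lipX : ∀ x, ∀ y ∈ Y, ∀ y' ∈ Y, ‖(H x y).1 - (H x y').1‖ ≤ L * ‖y - y'‖
  lipY : ∀ x x', ∀ y ∈ Y, ‖(H x y).2 - (H x' y).2‖ ≤ L * ‖x - x'‖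

namespace IsStronglyConvexConcave

variable {E F : Type*} [NormedAddCommGroup E] [InnerProductSpace ℝ E]
    [NormedAddCommGroup F] [InnerProductSpace ℝ F]
    {h : E → F → ℝ} {H : E → F → E × F} {Y : Set F} {L σ : ℝ}
    (hs : IsStronglyConvexConcave h H Y L σ)
include hs

theorem pos' : 0 < L := hs.pos.trans_le hs.le

theorem exists_min [FiniteDimensional ℝ E] {y : F} (hy : y ∈ Y) :
    ∃ xs, ∀ x, h xs y ≤ h x y := by
  have := FiniteDimensional.proper_real E
  refine exists_forall_le_of_lowerSemicontinuous (hs.cont y hy).lowerSemicontinuous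
    (x₀ := 0) (ρ := 2 * ‖(H 0 y).1‖ / σ) fun x hx => ?_
  have h1 := hs.lowerX y hy 0 x
  rw [sub_zero] at h1 hx
  have h2 := neg_le_of_abs_le (abs_real_inner_le_norm (H 0 y).1 x)
  rw [div_lt_iff₀ hs.pos] at hx
  nlinarith [norm_nonneg x]

variable {xs : E} {y : F}

theorem gradient_eq_zero (hy : y ∈ Y) (hmin : ∀ x, h xs y ≤ h x y) : (H xs y).1 = 0 := by
  have hL := hs.pos'
  have h1 := hs.upperX y hy xs (xs - (1 / L) • (H xs y).1)
  have h2 := hmin (xs - (1 / L) • (H xs y).1)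
  rw [sub_sub_cancel_left, inner_neg_right, inner_smul_right, norm_neg, norm_smul, mul_pow,
    real_inner_self_eq_norm_sq, Real.norm_eq_abs, sq_abs] at h1
  have h3 : L / 2 * ((1 / L) ^ 2 * ‖(H xs y).1‖ ^ 2) = 1 / L * ‖(H xs y).1‖ ^ 2 / 2 := by
    field_simp
  have h4 : 1 / L * ‖(H xs y).1‖ ^ 2 ≤ 0 := by linarith
  have h5 : ‖(H xs y).1‖ ^ 2 ≤ 0 := nonpos_of_mul_nonpos_right h4 (by positivity)
  simpa using le_antisymm h5 (sq_nonneg _)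

theorem add_sq_le (hy : y ∈ Y) (hmin : ∀ x, h xs y ≤ h x y) (x : E) :
    h xs y + σ / 2 * ‖x - xs‖ ^ 2 ≤ h x y := by
  simpa [hs.gradient_eq_zero hy hmin] using hs.lowerX y hy xs x

theorem le_add_sq (hy : y ∈ Y) (hmin : ∀ x, h xs y ≤ h x y) (x : E) :
    h x y ≤ h xs y + L / 2 * ‖x - xs‖ ^ 2 := by
  simpa [hs.gradient_eq_zero hy hmin] using hs.upperX y hy xs x

theorem norm_sub_le_of_le_add (hy : y ∈ Y) (hmin : ∀ x, h xs y ≤ h x y) {x : E} {ρ : ℝ}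
    (hρ : 0 ≤ ρ) (hx : h x y ≤ h xs y + σ / 2 * ρ ^ 2) : ‖x - xs‖ ≤ ρ := by
  have h1 := hs.add_sq_le hy hmin x
  refine le_of_sq_le_sq (le_of_mul_le_mul_left ?_ (half_pos hs.pos)) hρ
  linarith

theorem norm_min_sub_min_le {xs' : E} {y' : F} (hy : y ∈ Y) (hmin : ∀ x, h xs y ≤ h x y)
    (hy' : y' ∈ Y) (hmin' : ∀ x, h xs' y' ≤ h x y') : ‖xs - xs'‖ ≤ L / σ * ‖y - y'‖ := by
  have h1 := hs.add_sq_le hy hmin xs'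
  have h2 := hs.lowerX y hy xs' xs
  have h3 := hs.gradient_eq_zero hy' hmin'
  have h4 := hs.lipX xs' y hy y' hy'
  rw [h3, sub_zero] at h4
  have h5 := neg_le_of_abs_le (abs_real_inner_le_norm (H xs' y).1 (xs - xs'))
  rw [norm_sub_rev xs' xs] at h1
  have h6 : ‖(H xs' y).1‖ * ‖xs - xs'‖ ≤ L * ‖y - y'‖ * ‖xs - xs'‖ := by gcongr
  have h7 : (σ * ‖xs - xs'‖) * ‖xs - xs'‖ ≤ (L * ‖y - y'‖) * ‖xs - xs'‖ := by nlinarith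
  rw [div_mul_eq_mul_div, le_div_iff₀ hs.pos, mul_comm _ σ]
  rcases (norm_nonneg (xs - xs')).eq_or_lt with h | h
  · rw [← h, mul_zero]; exact mul_nonneg hs.pos'.le (norm_nonneg _)
  · exact le_of_mul_le_mul_right h7 h

theorem initial_potential_le (hy : y ∈ Y) (hmin : ∀ x, h xs y ≤ h x y) (x : E) :
    h x y - h xs y + σ / 2 * ‖x - xs‖ ^ 2 ≤ ‖(H x y).1‖ ^ 2 / σ := by
  have hσ := hs.pos
  have h1 := hs.add_sq_le hy hmin x
  have h2 := hs.lowerX y hy x xs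
  rw [norm_sub_rev xs x] at h2
  have h3 := neg_le_of_abs_le (abs_real_inner_le_norm (H x y).1 (xs - x))
  rw [norm_sub_rev xs x] at h3
  rw [le_div_iff₀ hσ]
  nlinarith [sq_nonneg (‖(H x y).1‖ - σ * ‖x - xs‖)]

theorem impStep_spec [FiniteDimensional ℝ E] {β εstep εmp εagd : ℝ} (hβ : β = 2 * L ^ 2 / σ)
    (hε : 0 < εstep) (hmp : εmp = 2 * σ / (5 * L) * Real.sqrt (2 * εstep / L))
    (hagd : εagd = σ * β ^ 2 * εmp ^ 2 / (32 * L ^ 2)) {w : F} (hw : w ∈ Y) {x₀ : E} {Γ : ℝ}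
    (hΓ : ∀ v ∈ Y, ‖(H x₀ v).1‖ ≤ Γ) {T : ℕ}
    (hT : (1 - 1 / Real.sqrt (L / σ)) ^ T * (Γ ^ 2 / σ) ≤ εagd) :
    (∃ r n, impStep h H Y L σ x₀ w β εstep r n) ∧
    ∀ r n, impStep h H Y L σ x₀ w β εstep r n →
      r.2 = proj Y (w + (1 / β) • (H r.1 w).2) ∧ (∀ x, h r.1 r.2 ≤ h x r.2 + εstep) ∧
      n ≤ (⌈Real.logb 2 (2 * Metric.diam Y / εmp)⌉₊ + 1) * (T + 1) := by
  have hσ := hs.pos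
  have hL := hs.pos'
  have hβ0 : 0 < β := by rw [hβ]; positivity
  have hmp0 : 0 < εmp := by rw [hmp]; positivity
  have hmp2 : εmp ^ 2 = 8 * σ ^ 2 * εstep / (25 * L ^ 3) := by
    rw [hmp, mul_pow, Real.sq_sqrt (by positivity)]; field_simp; norm_num
  have hρ : 0 ≤ 1 - 1 / Real.sqrt (L / σ) := by
    have : 1 ≤ Real.sqrt (L / σ) := Real.one_le_sqrt.2 ((one_le_div hσ).2 hs.le)
    rw [sub_nonneg, div_le_one (by positivity)]; exact this
  have hrun : ∀ v ∈ Y, ∀ xs, (∀ x, h xs v ≤ h x v) →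
      (∃ x n, agd (fun x => h x v) (fun x => (H x v).1) L σ x₀ εagd x n) ∧
      ∀ x n, agd (fun x => h x v) (fun x => (H x v).1) L σ x₀ εagd x n →
        h x v ≤ h xs v + εagd ∧ n ≤ T := fun v hv xs hxs =>
    agd_spec hσ hs.le hxs (hs.lowerX v hv) (hs.upperX v hv) (le_trans (by
      gcongr
      refine (hs.initial_potential_le hv hxs x₀).trans ?_
      have := hΓ v hv
      gcongr) hT)
  set D := Metric.diam Y with hD
  have hdist : ∀ a ∈ Y, ∀ b ∈ Y, ‖a - b‖ ≤ D := fun a ha b hb => by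
    rw [← dist_eq_norm]; exact Metric.dist_le_diam_of_mem hs.isCompact.isBounded ha hb
  set R := ⌈Real.logb 2 (2 * D / εmp)⌉₊ with hR
  let P : ℕ → E × F → Prop := fun r s => s.2 ∈ Y ∧ ∀ k, r = k + 1 →
    s.2 = proj Y (w + (1 / β) • (H s.1 w).2) ∧ ∃ v ∈ Y, (∀ x, h s.1 v ≤ h x v + εagd) ∧
      ‖s.2 - v‖ ≤ D / 2 ^ k + εmp
  have hP0 : P 0 (x₀, w) := ⟨hw, fun k hk => by omega⟩
  have hnear : ∀ v ∈ Y, ∀ xs, (∀ x, h xs v ≤ h x v) → ∀ x, (∀ x', h x v ≤ h x' v + εagd) →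
      ‖x - xs‖ ≤ β * εmp / (4 * L) := fun v hv xs hxs x hx =>
    hs.norm_sub_le_of_le_add hv hxs (by positivity) ((hx xs).trans_eq (by
      rw [hagd]; field_simp; ring))
  have hstep : ∀ i < R + 1, ∀ s s' m, P i s →
      ((agd (fun x => h x s.2) (fun x => (H x s.2).1) L σ x₀ εagd).bind fun x =>
        (Comp.call (fun x => (H x w).2) x).bind fun d =>
          Comp.ret (x, proj Y (w + (1 / β) • d))) s' m → P (i + 1) s' ∧ m ≤ T + 1 := by
    rintro i - s s' m ⟨hsY, hs1⟩ ⟨x, m₁, m₂, hx, ⟨d, m₃, m₄, ⟨rfl, rfl⟩, ⟨rfl, rfl⟩, rfl⟩, rfl⟩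
    obtain ⟨xs, hxs⟩ := hs.exists_min hsY
    obtain ⟨hval, hm⟩ := (hrun s.2 hsY xs hxs).2 x m₁ hx
    have hx' : ∀ x', h x s.2 ≤ h x' s.2 + εagd := fun x' => hval.trans (by linarith [hxs x'])
    refine ⟨⟨proj_mem hs.nonempty hs.isCompact _, ?_⟩, by omega⟩
    rintro k hk
    obtain rfl : i = k := by omega
    refine ⟨rfl, s.2, hsY, hx', ?_⟩
    obtain _ | k := i
    · have := hdist _ (proj_mem hs.nonempty hs.isCompact (w + (1 / β) • (H x w).2)) _ hsY
      simp only [pow_zero, div_one]; linarith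
    · obtain ⟨hpr, v, hv, hv', hvd⟩ := hs1 k rfl
      obtain ⟨vs, hvs⟩ := hs.exists_min hv
      have a1 := hnear _ hsY xs hxs x hx'
      have a2 := hnear _ hv vs hvs s.1 hv'
      have a3 := hs.norm_min_sub_min_le hsY hxs hv hvs
      have a4 : ‖x - s.1‖ ≤ β * εmp / (2 * L) + L / σ * ‖s.2 - v‖ := by
        calc ‖x - s.1‖ = ‖(x - xs) + (xs - vs) + (vs - s.1)‖ := by congr 1; abel
          _ ≤ ‖x - xs‖ + ‖xs - vs‖ + ‖vs - s.1‖ := norm_add₃_le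
          _ ≤ β * εmp / (4 * L) + L / σ * ‖s.2 - v‖ + β * εmp / (4 * L) := by
            rw [norm_sub_rev vs]; gcongr
          _ = _ := by ring
      have a5 := hs.lipY x s.1 w hw
      calc ‖proj Y (w + (1 / β) • (H x w).2) - s.2‖
          ≤ ‖(w + (1 / β) • (H x w).2) - (w + (1 / β) • (H s.1 w).2)‖ := by
            conv_lhs => rw [hpr]
            exact norm_proj_sub_proj_le hs.nonempty hs.isCompact hs.convex _ _
        _ = 1 / β * ‖(H x w).2 - (H s.1 w).2‖ := by
            rw [add_sub_add_left_eq_sub, ← smul_sub, norm_smul, Real.norm_of_nonneg (by positivity)]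
        _ ≤ 1 / β * (L * (β * εmp / (2 * L) + L / σ * (D / 2 ^ k + εmp))) := by
            gcongr; refine a5.trans ?_; gcongr; refine a4.trans ?_; gcongr
        _ = D / 2 ^ (k + 1) + εmp := by
            rw [hβ]; field_simp; ring
  constructor
  · obtain ⟨s, n, hsn, -⟩ := Comp.exists_forLoop P hP0 (N := R + 1)
      (body := fun _ s => (agd (fun x => h x s.2) (fun x => (H x s.2).1) L σ x₀ εagd).bind fun x =>
        (Comp.call (fun x => (H x w).2) x).bind fun d =>
          Comp.ret (x, proj Y (w + (1 / β) • d))) (by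
        rintro i hi s ⟨hsY, -⟩
        obtain ⟨xs, hxs⟩ := hs.exists_min hsY
        obtain ⟨x, n, hx⟩ := (hrun s.2 hsY xs hxs).1
        exact ⟨_, _, x, n, _, hx, ⟨_, _, _, ⟨rfl, rfl⟩, ⟨rfl, rfl⟩, rfl⟩, rfl⟩)
      (fun i hi s s' m h1 h2 => (hstep i hi s s' m h1 h2).1)
    refine ⟨s, n, ?_⟩
    unfold impStep
    simp only [← hmp, ← hagd, ← hD, ← hR]
    exact hsn
  · intro r n hr
    unfold impStep at hr
    simp only [← hmp, ← hagd, ← hD, ← hR] at hr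
    obtain ⟨⟨hY, h1⟩, hn⟩ := Comp.forLoop_invariant P hP0 hstep hr
    obtain ⟨hpr, v, hv, hv', hvd⟩ := h1 R rfl
    refine ⟨hpr, fun x => ?_, hn⟩
    obtain ⟨xs, hxs⟩ := hs.exists_min hY
    obtain ⟨vs, hvs⟩ := hs.exists_min hv
    have hpow : D / 2 ^ R ≤ εmp / 2 := by
      have hD0 : 0 ≤ D := Metric.diam_nonneg
      rcases hD0.eq_or_lt with h0 | h0
      · rw [← h0, zero_div]; positivity
      · have : 2 * D / εmp ≤ 2 ^ R := by
          rw [← Real.rpow_natCast, ← Real.logb_le_iff_le_rpow one_lt_two (by positivity)]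
          exact Nat.le_ceil _
        rw [div_le_iff₀ hmp0] at this
        rw [div_le_iff₀ (by positivity)]; linarith
    have a2 := hnear _ hv vs hvs r.1 hv'
    have a3 := hs.norm_min_sub_min_le hv hvs hY hxs
    have a4 : ‖r.1 - xs‖ ≤ 2 * L * εmp / σ := by
      calc ‖r.1 - xs‖ ≤ ‖r.1 - vs‖ + ‖vs - xs‖ := norm_sub_le_norm_sub_add_norm_sub _ _ _
        _ ≤ β * εmp / (4 * L) + L / σ * (3 / 2 * εmp) := by
          gcongr; refine a3.trans ?_; rw [norm_sub_rev]; gcongr; linarith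
        _ = _ := by rw [hβ]; field_simp; norm_num
    have a5 := hs.le_add_sq hY hxs r.1
    have a6 : L / 2 * ‖r.1 - xs‖ ^ 2 ≤ L / 2 * (2 * L * εmp / σ) ^ 2 := by gcongr
    have a7 : L / 2 * (2 * L * εmp / σ) ^ 2 = 16 / 25 * εstep := by
      rw [div_pow, mul_pow, hmp2]; field_simp; norm_num
    linarith [hxs x]

end IsStronglyConvexConcave

namespace IsStronglyConvexConcave

variable {E F : Type*} [NormedAddCommGroup E] [InnerProductSpace ℝ E]
    [NormedAddCommGroup F] [InnerProductSpace ℝ F]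
    {h : E → F → ℝ} {H : E → F → E × F} {Y : Set F} {L σ : ℝ}
    (hs : IsStronglyConvexConcave h H Y L σ)
include hs

/-- The progress of one step of the accelerated method on the dual function. -/
theorem dual_step {β : ℝ} (hβ : L ≤ β) {k : ℕ} {y z w d y₁ z₁ : F} {u : E} {ε τ η : ℝ}
    (hy : y ∈ Y) (hz : z ∈ Y) (hτ : τ = 2 / ((k : ℝ) + 2)) (hη : η = ((k : ℝ) + 1) / (2 * β))
    (hw : w = (1 - τ) • y + τ • z) (hd : d = (H u w).2) (hy₁ : y₁ = proj Y (w + (1 / β) • d))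
    (hz₁ : z₁ = proj Y (z + η • d)) (hu : ∀ x, h u y₁ ≤ h x y₁ + ε) {y' : F} (hy' : y' ∈ Y)
    (x : E) :
    (k : ℝ) * (k + 1) / 2 * h u y + (k + 1) * h u y' + β * (‖y' - z₁‖ ^ 2 - ‖y' - z‖ ^ 2) ≤
      ((k : ℝ) + 1) * (k + 2) / 2 * (h x y₁ + ε) := by
  have hβ0 : 0 < β := hs.pos'.trans_le hβ
  have hτ0 : 0 ≤ τ := by rw [hτ]; positivity
  have hτ1 : τ ≤ 1 := by
    rw [hτ, div_le_one (by positivity)]; linarith [(Nat.cast_nonneg k : (0 : ℝ) ≤ k)]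
  have hη0 : 0 < η := by rw [hη]; positivity
  have hy₁Y : y₁ ∈ Y := hy₁ ▸ proj_mem hs.nonempty hs.isCompact _
  have hz₁Y : z₁ ∈ Y := hz₁ ▸ proj_mem hs.nonempty hs.isCompact _
  have hwY : w ∈ Y := hw ▸ hs.convex hy hz (sub_nonneg.2 hτ1) hτ0 (by ring)
  have hŷ : (1 - τ) • y + τ • z₁ ∈ Y := hs.convex hy hz₁Y (sub_nonneg.2 hτ1) hτ0 (by ring)
  have e1 := hs.lowerY u w hwY y₁ hy₁Y
  have e2 := hs.upperY u w hwY y hy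
  have e3 := hs.upperY u w hwY y' hy'
  have e4 := inner_sub_le_of_proj hs.nonempty hs.isCompact hs.convex
    (one_div_pos.2 hβ0) w d hŷ
  have e5 := inner_sub_le_of_proj hs.nonempty hs.isCompact hs.convex hη0 z d hy'
  rw [← hy₁] at e4
  rw [← hz₁] at e5
  rw [← hd] at e1 e2 e3
  have n1 : ‖(1 - τ) • y + τ • z₁ - w‖ ^ 2 = τ ^ 2 * ‖z₁ - z‖ ^ 2 := by
    rw [hw, show (1 - τ) • y + τ • z₁ - ((1 - τ) • y + τ • z) = τ • (z₁ - z) by module, norm_smul,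
      mul_pow, Real.norm_eq_abs, sq_abs]
  have i1 : ⟪d, (1 - τ) • y + τ • z₁ - y₁⟫_ℝ
      = (1 - τ) * ⟪d, y - w⟫_ℝ + τ * ⟪d, z₁ - w⟫_ℝ - ⟪d, y₁ - w⟫_ℝ := by
    rw [← inner_smul_right, ← inner_smul_right, ← inner_add_right, ← inner_sub_right]
    congr 1; module
  have i2 : ⟪d, y' - z₁⟫_ℝ = ⟪d, y' - w⟫_ℝ - ⟪d, z₁ - w⟫_ℝ := by
    rw [← inner_sub_right]; congr 1; abel
  rw [i1, n1, show 1 / (2 * (1 / β)) = β / 2 by field_simp] at e4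
  rw [i2, show 1 / (2 * η) = β / (k + 1) by rw [hη]; field_simp] at e5
  have hP : L / 2 * ‖y₁ - w‖ ^ 2 ≤ β / 2 * ‖y₁ - w‖ ^ 2 := by gcongr
  have hM : 0 ≤ β / 2 * ‖(1 - τ) • y + τ • z₁ - y₁‖ ^ 2 := by positivity
  generalize ⟪d, y₁ - w⟫_ℝ = a at *
  generalize ⟪d, y - w⟫_ℝ = b at *
  generalize ⟪d, y' - w⟫_ℝ = e at *
  generalize ⟪d, z₁ - w⟫_ℝ = f at *
  have f1 : h u w + ((1 - τ) * b + τ * f) - β / 2 * (τ ^ 2 * ‖z₁ - z‖ ^ 2) ≤ h u y₁ := by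
    linarith
  have hA : (0 : ℝ) ≤ ((k : ℝ) + 1) * (k + 2) / 2 := by positivity
  have f2 := mul_le_mul_of_nonneg_left (f1.trans (hu x)) hA
  have f3 := mul_le_mul_of_nonneg_left e5 (by positivity : (0 : ℝ) ≤ (k : ℝ) + 1)
  have f4 : ((k : ℝ) + 1) * (β / (k + 1) * (‖y' - z‖ ^ 2 - ‖z₁ - z‖ ^ 2 - ‖y' - z₁‖ ^ 2))
      = β * (‖y' - z‖ ^ 2 - ‖z₁ - z‖ ^ 2 - ‖y' - z₁‖ ^ 2) := by field_simp
  have f5 : ((k : ℝ) + 1) * (k + 2) / 2 * (h u w + ((1 - τ) * b + τ * f)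
      - β / 2 * (τ ^ 2 * ‖z₁ - z‖ ^ 2)) = (k : ℝ) * (k + 1) / 2 * (h u w + b)
      + (k + 1) * (h u w + f) - ((k : ℝ) + 1) / (k + 2) * (β * ‖z₁ - z‖ ^ 2) := by
    rw [hτ]; field_simp; ring
  have f6 : ((k : ℝ) + 1) / (k + 2) * (β * ‖z₁ - z‖ ^ 2) ≤ 1 * (β * ‖z₁ - z‖ ^ 2) := by
    gcongr
    rw [div_le_one (by positivity)]; linarith
  have f7 := mul_le_mul_of_nonneg_left e2 (by positivity : (0 : ℝ) ≤ (k : ℝ) * (k + 1) / 2)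
  have f8 := mul_le_mul_of_nonneg_left e3 (by positivity : (0 : ℝ) ≤ (k : ℝ) + 1)
  linarith

theorem diag_spec [FiniteDimensional ℝ E] {β : ℝ} (hβ : β = 2 * L ^ 2 / σ)
    (hD : 0 < Metric.diam Y) {x₀ : E} {y₀ : F} (hy₀ : y₀ ∈ Y) {N : ℕ} (hN : 0 < N) {εstep : ℕ → ℝ}
    (hε : ∀ k : ℕ, εstep k = L ^ 2 * Metric.diam Y ^ 2 / (σ * (k : ℝ) ^ 3 * ((k : ℝ) + 1)))
    {m : ℝ} (hm : 0 < m)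
    (hmε : ∀ k < N, m ≤ 2 * σ / (5 * L) * Real.sqrt (2 * εstep (k + 1) / L)) {Γ : ℝ}
    (hΓ : ∀ v ∈ Y, ‖(H x₀ v).1‖ ≤ Γ) {T : ℕ}
    (hT : (1 - 1 / Real.sqrt (L / σ)) ^ T * (Γ ^ 2 / σ) ≤ σ * β ^ 2 * m ^ 2 / (32 * L ^ 2)) :
    (∃ r n, diag h H Y L σ x₀ y₀ N εstep r n) ∧
    ∀ r n, diag h H Y L σ x₀ y₀ N εstep r n → r.2 ∈ Y ∧
      (∀ x, ∀ y ∈ Y,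
        h r.1 y ≤ h x r.2 + 6 * L ^ 2 * Metric.diam Y ^ 2 / (σ * (N * (N + 1)))) ∧
      n ≤ N * ((⌈Real.logb 2 (2 * Metric.diam Y / m)⌉₊ + 1) * (T + 1) + 1) := by
  have hσ := hs.pos
  have hL := hs.pos'
  have hβL : L ≤ β := by
    rw [hβ, le_div_iff₀ hσ]; nlinarith [hs.le]
  have hβ0 : 0 < β := hL.trans_le hβL
  set D := Metric.diam Y with hDdef
  have hdist : ∀ a ∈ Y, ∀ b ∈ Y, ‖a - b‖ ≤ D := fun a ha b hb => by
    rw [← dist_eq_norm]; exact Metric.dist_le_diam_of_mem hs.isCompact.isBounded ha hb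
  set c := L ^ 2 * D ^ 2 / σ with hc
  have hc0 : 0 < c := by positivity
  let wt : ℕ → F × F × E → F := fun k s =>
    (1 - 2 / ((k : ℝ) + 2)) • s.1 + (2 / ((k : ℝ) + 2)) • s.2.1
  let body : ℕ → F × F × E → Comp (F × F × E) := fun k s =>
    (impStep h H Y L σ x₀ (wt k s) β (εstep (k + 1))).bind fun r =>
      (Comp.call (fun x => (H x (wt k s)).2) r.1).bind fun d =>
        Comp.ret (r.2, proj Y (s.2.1 + (((k : ℝ) + 1) / (2 * β)) • d),
          s.2.2 + ((k : ℝ) + 1) • r.1)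
  let P : ℕ → F × F × E → Prop := fun k s => s.1 ∈ Y ∧ s.2.1 ∈ Y ∧ ∀ y ∈ Y, ∀ a x,
    (k : ℝ) * (k + 1) / 2 * h a y + ⟪(H a y).1, s.2.2 - ((k : ℝ) * (k + 1) / 2) • a⟫_ℝ ≤
      (k : ℝ) * (k + 1) / 2 * h x s.1 - β * ‖y - s.2.1‖ ^ 2 + β * D ^ 2
        + c * (1 - 1 / ((k : ℝ) + 1))
  have hP0 : P 0 (y₀, y₀, 0) := by
    refine ⟨hy₀, hy₀, fun y hy a x => ?_⟩
    have h1 : ‖y - y₀‖ ^ 2 ≤ D ^ 2 := by gcongr; exact hdist _ hy _ hy₀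
    have h2 := mul_le_mul_of_nonneg_left h1 hβ0.le
    simp only [Nat.cast_zero, zero_mul, zero_div, zero_smul, sub_self, inner_zero_right,
      zero_add, div_one, mul_zero, add_zero, zero_sub]
    linarith
  have hwt : ∀ k s, s.1 ∈ Y → s.2.1 ∈ Y → wt k s ∈ Y := fun k s h1 h2 =>
    hs.convex h1 h2 (by
      rw [sub_nonneg, div_le_one (by positivity)]; linarith [(Nat.cast_nonneg k : (0 : ℝ) ≤ k)])
      (by positivity) (by ring)
  have himp : ∀ k < N, ∀ s, s.1 ∈ Y → s.2.1 ∈ Y →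
      (∃ r n, impStep h H Y L σ x₀ (wt k s) β (εstep (k + 1)) r n) ∧
      ∀ r n, impStep h H Y L σ x₀ (wt k s) β (εstep (k + 1)) r n →
        r.2 = proj Y (wt k s + (1 / β) • (H r.1 (wt k s)).2) ∧
        (∀ x, h r.1 r.2 ≤ h x r.2 + εstep (k + 1)) ∧
        n ≤ (⌈Real.logb 2 (2 * D / m)⌉₊ + 1) * (T + 1) := by
    intro k hk s h1 h2
    have hεp : 0 < εstep (k + 1) := by rw [hε]; push_cast; positivity
    obtain ⟨hex, hall⟩ := hs.impStep_spec hβ hεp rfl rfl (hwt k s h1 h2) hΓ (T := T)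
      (hT.trans (by have := hmε k hk; gcongr))
    refine ⟨hex, fun r n hr => ?_⟩
    obtain ⟨a1, a2, a3⟩ := hall r n hr
    refine ⟨a1, a2, a3.trans ?_⟩
    have hq := hmε k hk
    have hle := Nat.ceil_mono (Real.logb_le_logb_of_le one_lt_two
      (div_pos (by positivity) (hm.trans_le hq)) (by gcongr :
        2 * D / (2 * σ / (5 * L) * Real.sqrt (2 * εstep (k + 1) / L)) ≤ 2 * D / m))
    gcongr
  have hstep : ∀ k < N, ∀ s s' n, P k s → body k s s' n →
      P (k + 1) s' ∧ n ≤ (⌈Real.logb 2 (2 * D / m)⌉₊ + 1) * (T + 1) + 1 := by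
    rintro k hk s s' n ⟨hsy, hsz, hinv⟩
      ⟨r, n₁, n₂, hr, ⟨d, n₃, n₄, ⟨rfl, rfl⟩, ⟨rfl, rfl⟩, rfl⟩, rfl⟩
    obtain ⟨a1, a2, a3⟩ := (himp k hk s hsy hsz).2 r n₁ hr
    refine ⟨⟨?_, proj_mem hs.nonempty hs.isCompact _, fun y hy a x => ?_⟩, by omega⟩
    · change r.2 ∈ Y
      rw [a1]; exact proj_mem hs.nonempty hs.isCompact _
    · have b1 := hs.dual_step hβL hsy hsz rfl rfl rfl rfl a1 rfl a2 hy x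
      have b2 := hinv y hy a r.1
      have b3 := hs.lowerX y hy a r.1
      have b4 : 0 ≤ σ / 2 * ‖r.1 - a‖ ^ 2 := by positivity
      have b5 := mul_le_mul_of_nonneg_left (show h a y + ⟪(H a y).1, r.1 - a⟫_ℝ ≤ h r.1 y by
        linarith) (by positivity : (0 : ℝ) ≤ (k : ℝ) + 1)
      have b6 : ⟪(H a y).1, s.2.2 + ((k : ℝ) + 1) • r.1
          - (((k + 1 : ℕ) : ℝ) * (((k + 1 : ℕ) : ℝ) + 1) / 2) • a⟫_ℝ
          = ⟪(H a y).1, s.2.2 - ((k : ℝ) * (k + 1) / 2) • a⟫_ℝ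
            + ((k : ℝ) + 1) * ⟪(H a y).1, r.1 - a⟫_ℝ := by
        rw [← inner_smul_right, ← inner_add_right]
        congr 1; push_cast; module
      have b7 : ((k : ℝ) + 1) * (k + 2) / 2 * εstep (k + 1)
          ≤ c * (1 / ((k : ℝ) + 1) - 1 / (k + 2)) := by
        have : ((k : ℝ) + 1) * (k + 2) / 2 * εstep (k + 1) = c * (1 / (2 * ((k : ℝ) + 1) ^ 2)) := by
          rw [hε, hc]; push_cast; rw [show (k : ℝ) + 1 + 1 = k + 2 by ring]; field_simp
        rw [this]
        gcongr
        rw [div_sub_div _ _ (by positivity) (by positivity), div_le_div_iff₀ (by positivity)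
          (by positivity)]
        have : (0 : ℝ) ≤ k := Nat.cast_nonneg k
        nlinarith
      simp only [] at b1 ⊢
      rw [b6]
      push_cast
      rw [show (k : ℝ) + 1 + 1 = k + 2 by ring]
      linarith
  have hdiag : diag h H Y L σ x₀ y₀ N εstep = (Comp.forLoop body N (y₀, y₀, 0)).bind fun s =>
      Comp.ret ((2 / ((N : ℝ) * ((N : ℝ) + 1))) • s.2.2, s.1) := by
    simp only [diag, ← hβ]; rfl
  rw [hdiag]
  constructor
  · obtain ⟨s, n, hsn, -⟩ := Comp.exists_forLoop P hP0 (N := N) (body := body) (by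
        rintro k hk s ⟨h1, h2, -⟩
        obtain ⟨r, n, hr⟩ := (himp k hk s h1 h2).1
        exact ⟨_, _, r, n, _, hr, ⟨_, _, _, ⟨rfl, rfl⟩, ⟨rfl, rfl⟩, rfl⟩, rfl⟩)
      (fun i hi s s' m h1 h2 => (hstep i hi s s' m h1 h2).1)
    exact ⟨_, _, s, n, 0, hsn, ⟨rfl, rfl⟩, rfl⟩
  · rintro r n ⟨s, n₁, n₂, hsn, ⟨rfl, rfl⟩, rfl⟩
    obtain ⟨⟨h1, -, h2⟩, hn⟩ := Comp.forLoop_invariant P hP0 hstep hsn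
    refine ⟨h1, fun x y hy => ?_, hn⟩
    have hN' : (0 : ℝ) < N := Nat.cast_pos.2 hN
    have b := h2 y hy ((2 / ((N : ℝ) * ((N : ℝ) + 1))) • s.2.2) x
    rw [smul_smul, show (N : ℝ) * (N + 1) / 2 * (2 / ((N : ℝ) * ((N : ℝ) + 1))) = 1 by field_simp,
      one_smul, sub_self, inner_zero_right, add_zero] at b
    have b1 : 0 ≤ β * ‖y - s.2.1‖ ^ 2 := by positivity
    have b2 : 0 ≤ c * (1 / ((N : ℝ) + 1)) := by positivity
    have b3 : β * D ^ 2 = 2 * c := by rw [hβ, hc]; ring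
    refine le_of_mul_le_mul_left (a := (N : ℝ) * (N + 1) / 2) ?_ (by positivity)
    have b4 : (N : ℝ) * (N + 1) / 2 * (6 * L ^ 2 * D ^ 2 / (σ * (N * (N + 1)))) = 3 * c := by
      rw [hc]; field_simp; norm_num
    change (N : ℝ) * (N + 1) / 2 * h ((2 / ((N : ℝ) * ((N : ℝ) + 1))) • s.2.2) y ≤
      (N : ℝ) * (N + 1) / 2 * (h x s.1 + _)
    rw [mul_add ((N : ℝ) * (N + 1) / 2) (h x s.1), b4]
    linarith

end IsStronglyConvexConcave

theorem mul_norm_sub_sq_eq {V : Type*} [NormedAddCommGroup V] [InnerProductSpace ℝ V] (L : ℝ)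
    (c x x' : V) : L * ‖x' - c‖ ^ 2
      = L * ‖x - c‖ ^ 2 + ⟪(2 * L) • (x - c), x' - x⟫_ℝ + L * ‖x' - x‖ ^ 2 := by
  rw [show x' - c = (x - c) + (x' - x) by abel, norm_add_sq_real, inner_smul_left]
  simp only [conj_trivial]; ring

theorem maxFun_le_proxModel {E F : Type*} [NormedAddCommGroup E] {g : E → F → ℝ}
    {Y : Set F} {L : ℝ}
    (hL : 0 < L) (c x : E) : maxFun g Y x ≤ proxModel g Y L c x := by
  have : 0 ≤ L * ‖x - c‖ ^ 2 := by positivity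
  unfold proxModel; linarith

theorem proxModel_self {E F : Type*} [NormedAddCommGroup E] {g : E → F → ℝ}
    {Y : Set F} {L : ℝ}
    (c : E) : proxModel g Y L c c = maxFun g Y c := by
  simp [proxModel]

theorem maxFun_lt_of_not_shouldStop {E F : Type*} [NormedAddCommGroup E] {g : E → F → ℝ}
    {Y : Set F} {L : ℝ} (hL : 0 < L) {ε : ℝ} {c x' : E}
    (h : ¬ ShouldStop g Y L ε c x') :
    maxFun g Y x' < maxFun g Y c - 3 * tildeEps L ε / 4 :=
  (maxFun_le_proxModel hL c x').trans_lt (not_le.1 h)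

namespace IsNonconvexConcave

variable {E F : Type*} [NormedAddCommGroup E] [InnerProductSpace ℝ E]
  [NormedAddCommGroup F] [InnerProductSpace ℝ F] [CompleteSpace E] [CompleteSpace F]
  {g : E → F → ℝ} {G : E → F → E × F} {Y : Set F} {L : ℝ}
  (hg : IsNonconvexConcave g G Y L)
include hg

theorem le_maxFun (x : E) {y : F} (hy : y ∈ Y) : g x y ≤ maxFun g Y x := by
  have hcont : ContinuousOn (g x) Y := fun y hy =>
    (hg.gradY x y hy).hasFDerivWithinAt.continuousWithinAt
  have hb := (hg.isCompact.image_of_continuousOn hcont).bddAbove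
  refine le_ciSup (f := fun y : Y => g x y) (hb.mono ?_) ⟨y, hy⟩
  rintro _ ⟨y, rfl⟩
  exact ⟨y, y.2, rfl⟩

theorem maxFun_le {x : E} {a : ℝ} (h : ∀ y ∈ Y, g x y ≤ a) : maxFun g Y x ≤ a :=
  have : Nonempty Y := hg.nonempty.to_subtype
  ciSup_le fun y => h y y.2

theorem abs_sub_sub_inner_fst_le {y : F} (hy : y ∈ Y) (x x' : E) :
    |g x' y - g x y - ⟪(G x y).1, x' - x⟫_ℝ| ≤ L / 2 * ‖x' - x‖ ^ 2 :=
  abs_sub_sub_inner_le (φ := fun x => g x y) (d := fun x => (G x y).1) convex_univ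
    (fun x _ => hasGradientWithinAt_univ.2 (hg.gradX x y hy))
    (fun x _ x' _ => by simpa using (le_max_left _ _).trans (hg.smooth x x' y hy y hy))
    (Set.mem_univ x) (Set.mem_univ x')

theorem abs_sub_sub_inner_snd_le (x : E) {y y' : F} (hy : y ∈ Y) (hy' : y' ∈ Y) :
    |g x y' - g x y - ⟪(G x y).2, y' - y⟫_ℝ| ≤ L / 2 * ‖y' - y‖ ^ 2 :=
  abs_sub_sub_inner_le (φ := g x) (d := fun y => (G x y).2) hg.convex (hg.gradY x)
    (fun y hy y' hy' => by simpa using (le_max_right _ _).trans (hg.smooth x x y hy y' hy'))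
    hy hy'

/-- The proximal regularization of `g` is strongly convex in the first variable. -/
theorem isStronglyConvexConcave (hL : 0 < L) (c : E) :
    IsStronglyConvexConcave (fun x y => g x y + L * ‖x - c‖ ^ 2)
      (fun x y => ((G x y).1 + (2 * L) • (x - c), (G x y).2)) Y (3 * L) L where
  nonempty := hg.nonempty
  isCompact := hg.isCompact
  convex := hg.convex
  pos := hL
  le := by linarith
  cont y hy := by
    have : Continuous fun x => g x y := continuous_iff_continuousAt.2 fun x =>
      (hg.gradX x y hy).continuousAt
    fun_prop
  lowerX y hy x x' := by
    have h1 := (abs_le.1 (hg.abs_sub_sub_inner_fst_le hy x x')).1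
    simp only [mul_norm_sub_sq_eq L c x x', inner_add_left]
    linarith
  upperX y hy x x' := by
    have h1 := (abs_le.1 (hg.abs_sub_sub_inner_fst_le hy x x')).2
    simp only [mul_norm_sub_sq_eq L c x x', inner_add_left]
    linarith
  lowerY x y hy y' hy' := by
    have h1 := (abs_le.1 (hg.abs_sub_sub_inner_snd_le x hy hy')).1
    have h2 : 0 ≤ L * ‖y' - y‖ ^ 2 := by positivity
    simp only []
    linarith
  upperY x y hy y' hy' := by
    have h1 := le_add_inner_of_concaveOn (hg.concave x) (d := (G x y).2) (half_pos hL).le hy hy'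
      fun y' hy' => by linarith [(abs_le.1 (hg.abs_sub_sub_inner_snd_le x hy hy')).2]
    simp only []
    linarith
  lipX x y hy y' hy' := by
    have h1 := (le_max_left _ _).trans (hg.smooth x x y hy y' hy')
    rw [sub_self, norm_zero, zero_add] at h1
    simp only [add_sub_add_right_eq_sub]
    refine h1.trans ?_
    gcongr
    linarith
  lipY x x' y hy := by
    have h1 := (le_max_right _ _).trans (hg.smooth x x' y hy y hy)
    rw [sub_self, norm_zero, add_zero] at h1
    refine h1.trans ?_
    gcongr
    linarith

theorem lowerSemicontinuous_maxFun : LowerSemicontinuous (maxFun g Y) := by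
  intro x a ha
  by_contra hcon
  have : maxFun g Y x ≤ a := hg.maxFun_le fun y hy => by
    by_contra! hlt
    have hc : ContinuousAt (fun x => g x y) x := (hg.gradX x y hy).continuousAt
    exact hcon ((hc.eventually (lt_mem_nhds hlt)).mono fun x' hx' =>
      hx'.trans_le (hg.le_maxFun x' hy))
  exact absurd ha this.not_gt

theorem exists_min_proxModel [FiniteDimensional ℝ E] (hL : 0 < L) {fstar : ℝ}
    (hf : ∀ x, fstar ≤ maxFun g Y x) (c : E) :
    ∃ xs, ∀ x, proxModel g Y L c xs ≤ proxModel g Y L c x := by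
  have := FiniteDimensional.proper_real E
  refine exists_forall_le_of_lowerSemicontinuous (x₀ := c)
    (ρ := Real.sqrt ((maxFun g Y c - fstar) / L))
    (hg.lowerSemicontinuous_maxFun.add
      (by fun_prop : Continuous fun x => L * ‖x - c‖ ^ 2).lowerSemicontinuous) fun x hx => ?_
  have h1 := Real.lt_sq_of_sqrt_lt hx
  rw [div_lt_iff₀ hL] at h1
  have h2 := hf x
  change proxModel g Y L c c ≤ maxFun g Y x + L * ‖x - c‖ ^ 2
  rw [proxModel_self]
  linarith

theorem proxModel_add_sq_le (hL : 0 < L) {c xs : E}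
    (hmin : ∀ x, proxModel g Y L c xs ≤ proxModel g Y L c x) (x : E) :
    proxModel g Y L c xs + L / 2 * ‖x - xs‖ ^ 2 ≤ proxModel g Y L c x := by
  refine le_of_forall_le_add_mul (c := L / 2 * ‖x - xs‖ ^ 2) (by positivity) fun t ht0 ht1 => ?_
  set m := (1 - t) • xs + t • x with hm
  have h1 : proxModel g Y L c m ≤ (1 - t) * proxModel g Y L c xs + t * proxModel g Y L c x
      - t * (1 - t) * (L / 2 * ‖x - xs‖ ^ 2) := by
    have : maxFun g Y m ≤ (1 - t) * proxModel g Y L c xs + t * proxModel g Y L c x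
        - t * (1 - t) * (L / 2 * ‖x - xs‖ ^ 2) - L * ‖m - c‖ ^ 2 := by
      refine hg.maxFun_le fun y hy => ?_
      have e1 := (hg.isStronglyConvexConcave hL c).lowerX y hy m xs
      have e2 := (hg.isStronglyConvexConcave hL c).lowerX y hy m x
      have d1 : xs - m = (-t) • (x - xs) := by rw [hm]; module
      have d2 : x - m = (1 - t) • (x - xs) := by rw [hm]; module
      rw [d1, inner_smul_right, norm_smul, mul_pow, Real.norm_eq_abs, sq_abs] at e1
      rw [d2, inner_smul_right, norm_smul, mul_pow, Real.norm_eq_abs, sq_abs] at e2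
      have k1 := mul_le_mul_of_nonneg_left e1 (sub_nonneg.2 ht1.le)
      have k2 := mul_le_mul_of_nonneg_left e2 ht0.le
      have k3 := mul_le_mul_of_nonneg_left (hg.le_maxFun xs hy) (sub_nonneg.2 ht1.le)
      have k4 := mul_le_mul_of_nonneg_left (hg.le_maxFun x hy) ht0.le
      simp only [proxModel]
      linarith
    rw [proxModel]; linarith
  have h2 := (hmin m).trans h1
  have h3 : t * (proxModel g Y L c xs + L / 2 * ‖x - xs‖ ^ 2)
      ≤ t * (proxModel g Y L c x + t * (L / 2 * ‖x - xs‖ ^ 2)) := by linarith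
  exact le_of_mul_le_mul_left h3 ht0

theorem hasGradientAt_moreauEnvelope [FiniteDimensional ℝ E] (hL : 0 < L) {fstar : ℝ}
    (hf : ∀ x, fstar ≤ maxFun g Y x) {c xs : E}
    (hmin : ∀ x, proxModel g Y L c xs ≤ proxModel g Y L c x) :
    HasGradientAt (moreauEnvelope (maxFun g Y) (1 / (2 * L))) ((2 * L) • (c - xs)) c := by
  have hM : ∀ x, moreauEnvelope (maxFun g Y) (1 / (2 * L)) x = ⨅ u, proxModel g Y L x u := by
    intro x
    simp only [moreauEnvelope, proxModel]
    congr 1; funext u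
    rw [norm_sub_rev, show 1 / (2 * (1 / (2 * L))) = L by field_simp]
  have hne : Nonempty E := ⟨c⟩
  have hle : ∀ x u, ⨅ u, proxModel g Y L x u ≤ proxModel g Y L x u := fun x u =>
    ciInf_le ⟨fstar, by rintro _ ⟨u, rfl⟩; exact (hf u).trans (maxFun_le_proxModel hL x u)⟩ u
  have hc : ⨅ u, proxModel g Y L c u = proxModel g Y L c xs := iInf_eq_of_forall_le hmin
  have hshift : ∀ x u, proxModel g Y L x u = proxModel g Y L c u
      + 2 * L * ⟪c - u, x - c⟫_ℝ + L * ‖x - c‖ ^ 2 := by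
    intro x u
    have := mul_norm_sub_sq_eq L u c x
    rw [inner_smul_left] at this
    simp only [conj_trivial] at this
    simp only [proxModel, norm_sub_rev u]
    linarith
  rw [hasGradientAt_iff_isLittleO]
  refine Asymptotics.IsBigO.trans_isLittleO (.of_bound L (.of_forall fun x => ?_))
    (Asymptotics.isLittleO_pow_sub_sub c one_lt_two)
  rw [hM, hM, hc, Real.norm_of_nonneg (by positivity : 0 ≤ ‖x - c‖ ^ 2), Real.norm_eq_abs, abs_le,
    inner_smul_left]
  simp only [conj_trivial]
  constructor
  · have : proxModel g Y L c xs + 2 * L * ⟪c - xs, x - c⟫_ℝ - L * ‖x - c‖ ^ 2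
        ≤ ⨅ u, proxModel g Y L x u := by
      refine le_ciInf fun u => ?_
      have h1 := hg.proxModel_add_sq_le hL hmin u
      have h2 : ⟪c - xs, x - c⟫_ℝ - ⟪c - u, x - c⟫_ℝ ≤ ‖u - xs‖ * ‖x - c‖ := by
        rw [← inner_sub_left, sub_sub_sub_cancel_left]; exact real_inner_le_norm _ _
      have h3 := mul_le_mul_of_nonneg_left h2 (by positivity : 0 ≤ 2 * L)
      have h4 : 0 ≤ L / 2 * (‖u - xs‖ - 2 * ‖x - c‖) ^ 2 := by positivity
      rw [hshift x u]
      linarith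
    linarith
  · have h1 := hle x xs
    rw [hshift] at h1
    linarith

theorem isFOSP_of_shouldStop [FiniteDimensional ℝ E] (hL : 0 < L) {fstar : ℝ}
    (hf : ∀ x, fstar ≤ maxFun g Y x) {ε : ℝ} (hε : 0 < ε) {c x' : E}
    (hacc : InnerAccurate g Y L ε c x') (hterm : ShouldStop g Y L ε c x') :
    IsFOSP (maxFun g Y) L ε c := by
  obtain ⟨xs, hmin⟩ := hg.exists_min_proxModel hL hf c
  refine ⟨_, hg.hasGradientAt_moreauEnvelope hL hf hmin, ?_⟩
  have h1 := hg.proxModel_add_sq_le hL hmin c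
  have h2 := hacc xs
  unfold ShouldStop at hterm
  rw [proxModel_self] at h1
  have h3 : L / 2 * ‖c - xs‖ ^ 2 ≤ ε ^ 2 / (64 * L) := by
    rw [tildeEps] at h2 hterm; linarith
  rw [le_div_iff₀ (by positivity)] at h3
  rw [norm_smul, Real.norm_of_nonneg (by positivity)]
  refine le_of_sq_le_sq ?_ hε.le
  nlinarith [sq_nonneg ε]

theorem norm_fst_le (hL : 0 < L) {fstar : ℝ} (hf : ∀ x, fstar ≤ maxFun g Y x) (c : E) {v : F}
    (hv : v ∈ Y) :
    ‖(G c v).1‖ ≤ L * Metric.diam Y + Real.sqrt (2 * L * (maxFun g Y c - fstar)) := by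
  set d := (G c v).1 with hd
  set D := Metric.diam Y
  by_cases hle : ‖d‖ ≤ L * D
  · exact hle.trans (le_add_of_nonneg_right (Real.sqrt_nonneg _))
  have ha : 0 < ‖d‖ - L * D := by linarith
  have hD : 0 ≤ D := Metric.diam_nonneg
  have hd0 : 0 < ‖d‖ := by
    have : 0 ≤ L * D := by positivity
    linarith
  set a := ‖d‖ - L * D with haeq
  set n : E := (1 / ‖d‖) • d with hn
  have hn1 : ‖n‖ = 1 := by
    rw [hn, norm_smul, Real.norm_of_nonneg (by positivity)]; field_simp
  have key : maxFun g Y (c - (a / L) • n) ≤ maxFun g Y c - a ^ 2 / (2 * L) := by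
    refine hg.maxFun_le fun y hy => ?_
    have h1 := (abs_le.1 (hg.abs_sub_sub_inner_fst_le hy c (c - (a / L) • n))).2
    rw [sub_sub_cancel_left, inner_neg_right, inner_smul_right, norm_neg, norm_smul, hn1, mul_one,
      Real.norm_of_nonneg (by positivity)] at h1
    have h2 : ‖d - (G c y).1‖ ≤ L * D := by
      have := (le_max_left _ _).trans (hg.smooth c c v hv y hy)
      rw [sub_self, norm_zero, zero_add] at this
      refine this.trans ?_
      gcongr
      rw [← dist_eq_norm]
      exact Metric.dist_le_diam_of_mem hg.isCompact.isBounded hv hy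
    have h3 : ⟪d, n⟫_ℝ = ‖d‖ := by
      rw [hn, inner_smul_right, real_inner_self_eq_norm_sq]; field_simp
    have h4 : ⟪d - (G c y).1, n⟫_ℝ ≤ L * D :=
      (real_inner_le_norm _ _).trans (by rw [hn1, mul_one]; exact h2)
    rw [inner_sub_left, h3] at h4
    have h5 : a / L * a ≤ a / L * ⟪(G c y).1, n⟫_ℝ := by gcongr; linarith
    have h6 : a / L * a = a ^ 2 / L := by ring
    have h7 : L / 2 * (a / L) ^ 2 = a ^ 2 / (2 * L) := by field_simp
    have h8 : a ^ 2 / L = 2 * (a ^ 2 / (2 * L)) := by field_simp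
    linarith [hg.le_maxFun c hy]
  have h1 := (hf _).trans key
  have h2 : a ^ 2 / (2 * L) ≤ maxFun g Y c - fstar := by linarith
  rw [div_le_iff₀ (by positivity)] at h2
  have h3 : a ≤ Real.sqrt (2 * L * (maxFun g Y c - fstar)) :=
    Real.le_sqrt_of_sq_le (by linarith)
  linarith

theorem innerSolve_spec [FiniteDimensional ℝ E] (hL : 0 < L) {ε : ℝ} (hε : 0 < ε)
    (hD : 0 < Metric.diam Y) {y₀ : F} (hy₀ : y₀ ∈ Y) (c : E) {Γ : ℝ}
    (hΓ : ∀ v ∈ Y, ‖(G c v).1‖ ≤ Γ) {N T : ℕ}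
    (hN : N = ⌈Real.sqrt (6 * (3 * L) ^ 2 * Metric.diam Y ^ 2 / (L * (tildeEps L ε / 4)))⌉₊)
    (hT : 200 * Γ ^ 2 * N ^ 4 ≤ 2 ^ T * (9 * L ^ 2 * Metric.diam Y ^ 2)) :
    (∃ x' n, innerSolve g G Y L ε y₀ c x' n) ∧
    ∀ x' n, innerSolve g G Y L ε y₀ c x' n → InnerAccurate g Y L ε c x' ∧
      n ≤ N * ((⌈Real.logb 2 (10 * (N : ℝ) ^ 2)⌉₊ + 1) * (T + 1) + 1) := by
  have hδ : 0 < tildeEps L ε / 4 := by unfold tildeEps; positivity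
  set δ := tildeEps L ε / 4 with hδdef
  set D := Metric.diam Y with hDdef
  have hN0 : 0 < N := by rw [hN, Nat.ceil_pos]; positivity
  have hN' : (0 : ℝ) < N := Nat.cast_pos.2 hN0
  have hNsq : 6 * (3 * L) ^ 2 * D ^ 2 / (L * δ) ≤ (N : ℝ) ^ 2 := by
    refine (Real.sqrt_le_left hN'.le).1 ?_
    rw [hN]; exact Nat.le_ceil _
  have hs := hg.isStronglyConvexConcave hL c
  have hm : 0 < D / (5 * N ^ 2) := by positivity
  obtain ⟨hex, hall⟩ := hs.diag_spec rfl hD (x₀ := c) hy₀ hN0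
    (εstep := fun k => (3 * L) ^ 2 * D ^ 2 / (L * (k : ℝ) ^ 3 * ((k : ℝ) + 1)))
    (fun k => rfl) hm (Γ := Γ) (T := T) (by
      intro k hk
      have hk' : (k : ℝ) + 1 ≤ N := by exact_mod_cast hk
      rw [← div_le_iff₀' (by positivity)]
      refine Real.le_sqrt_of_sq_le ?_
      have h1 : ((k : ℝ) + 1) ^ 3 * (k + 1 + 1) ≤ (N : ℝ) ^ 3 * (N + N) := by
        gcongr
        exact_mod_cast hN0
      have e1 : (D / (5 * (N : ℝ) ^ 2) / (2 * L / (5 * (3 * L)))) ^ 2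
          = 9 / 4 * D ^ 2 / (N : ℝ) ^ 4 := by field_simp; norm_num
      have e2 : 2 * ((3 * L) ^ 2 * D ^ 2 / (L * ((k + 1 : ℕ) : ℝ) ^ 3 * (((k + 1 : ℕ) : ℝ) + 1)))
          / (3 * L) = 6 * D ^ 2 / (((k : ℝ) + 1) ^ 3 * (k + 1 + 1)) := by
        push_cast; field_simp; norm_num
      rw [e1, e2, div_le_div_iff₀ (by positivity) (by positivity)]
      have h2 : 9 / 4 * D ^ 2 * (((k : ℝ) + 1) ^ 3 * (k + 1 + 1))
          ≤ 9 / 4 * D ^ 2 * ((N : ℝ) ^ 3 * (N + N)) := by gcongr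
      have h3 : 0 ≤ D ^ 2 * (N : ℝ) ^ 4 := by positivity
      linarith) (by
      intro v hv
      simpa using hΓ v hv) (by
      have h3 : (1 : ℝ) - 1 / Real.sqrt (3 * L / L) ≤ 1 / 2 := by
        rw [mul_div_cancel_right₀ _ hL.ne']
        have : Real.sqrt 3 ≤ 2 := by
          rw [Real.sqrt_le_left (by norm_num)]; norm_num
        have := one_div_le_one_div_of_le (by positivity) this
        linarith
      have h4 : (0 : ℝ) ≤ 1 - 1 / Real.sqrt (3 * L / L) := by
        rw [mul_div_cancel_right₀ _ hL.ne', sub_nonneg, div_le_one (by positivity),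
          Real.one_le_sqrt]
        norm_num
      have e1 : L * (2 * (3 * L) ^ 2 / L) ^ 2 * (D / (5 * (N : ℝ) ^ 2)) ^ 2 / (32 * (3 * L) ^ 2)
          = 9 * L * D ^ 2 / (200 * (N : ℝ) ^ 4) := by field_simp; norm_num
      rw [e1]
      calc _ ≤ (1 / 2 : ℝ) ^ T * (Γ ^ 2 / L) := by gcongr
        _ ≤ _ := by
          rw [one_div, inv_pow, inv_mul_eq_div, div_div, div_le_div_iff₀ (by positivity)
            (by positivity)]
          nlinarith)
  have hdef : innerSolve g G Y L ε y₀ c = (diag (fun x y => g x y + L * ‖x - c‖ ^ 2)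
      (fun x y => ((G x y).1 + (2 * L) • (x - c), (G x y).2)) Y (3 * L) L c y₀ N
      (fun k => (3 * L) ^ 2 * D ^ 2 / (L * (k : ℝ) ^ 3 * ((k : ℝ) + 1)))).bind
        fun r => Comp.ret r.1 := by
    rw [hN]; rfl
  rw [hdef]
  constructor
  · obtain ⟨r, n, hr⟩ := hex
    exact ⟨r.1, n, r, n, 0, hr, ⟨rfl, rfl⟩, rfl⟩
  · rintro x' n ⟨r, n₁, n₂, hr, ⟨rfl, rfl⟩, rfl⟩
    obtain ⟨h1, h2, h3⟩ := hall r _ hr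
    refine ⟨fun x => ?_, by
      rwa [show 2 * D / (D / (5 * (N : ℝ) ^ 2)) = 10 * (N : ℝ) ^ 2 by field_simp; norm_num] at h3⟩
    have h4 : 6 * (3 * L) ^ 2 * D ^ 2 / (L * (N * (N + 1))) ≤ δ := by
      rw [div_le_iff₀ (by positivity)] at hNsq ⊢
      have : 0 ≤ L * δ * N := by positivity
      linarith
    have h5 : maxFun g Y r.1 ≤ g x r.2 + L * ‖x - c‖ ^ 2 + δ - L * ‖r.1 - c‖ ^ 2 :=
      hg.maxFun_le fun y hy => by
        have := h2 x y hy
        linarith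
    have h6 := hg.le_maxFun x h1
    simp only [proxModel]
    linarith

end IsNonconvexConcave

theorem le_outerSteps_mul {L ε gap : ℝ} (hL : 0 < L) (hε : 0 < ε) :
    gap ≤ (max (outerSteps L ε gap) 1 : ℕ) * (3 * tildeEps L ε / 4) := by
  have h1 : 4 ^ 4 * L * gap / (3 * ε ^ 2) ≤ (max (outerSteps L ε gap) 1 : ℕ) :=
    (Nat.le_ceil _).trans (Nat.cast_le.2 (le_max_left _ _))
  rw [div_le_iff₀ (by positivity)] at h1
  rw [tildeEps, show ((max (outerSteps L ε gap) 1 : ℕ) : ℝ) * (3 * (ε ^ 2 / (64 * L)) / 4)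
    = (max (outerSteps L ε gap) 1 : ℕ) * (3 * ε ^ 2) / (4 ^ 4 * L) by field_simp; norm_num,
    le_div_iff₀ (by positivity)]
  linarith

namespace IsNonconvexConcave

variable {E F : Type*} [NormedAddCommGroup E] [InnerProductSpace ℝ E]
  [NormedAddCommGroup F] [InnerProductSpace ℝ F] [FiniteDimensional ℝ E] [CompleteSpace E]
  [CompleteSpace F] {g : E → F → ℝ} {G : E → F → E × F} {Y : Set F} {L : ℝ}
  (hg : IsNonconvexConcave g G Y L)
include hg

/-- Prox-DIAG with arbitrary sufficiently accurate inner solutions. -/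
theorem exists_shouldStop (hL : 0 < L) {ε : ℝ} (hε : 0 < ε) {fstar : ℝ}
    (hf : ∀ x, fstar ≤ maxFun g Y x) {x : ℕ → E}
    (hx : ∀ k, (∀ j < k, ¬ ShouldStop g Y L ε (x j) (x (j + 1))) →
      InnerAccurate g Y L ε (x k) (x (k + 1))) :
    ∃ k, k + 1 ≤ max (outerSteps L ε (maxFun g Y (x 0) - fstar)) 1 ∧
      (∀ j < k, ¬ ShouldStop g Y L ε (x j) (x (j + 1))) ∧
      ShouldStop g Y L ε (x k) (x (k + 1)) ∧ IsFOSP (maxFun g Y) L ε (x k) := by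
  classical
  have hM := le_outerSteps_mul (gap := maxFun g Y (x 0) - fstar) hL hε
  set M := max (outerSteps L ε (maxFun g Y (x 0) - fstar)) 1 with hMdef
  have hM1 : 1 ≤ M := le_max_right _ _
  have hex : ∃ k, k < M ∧ ShouldStop g Y L ε (x k) (x (k + 1)) := by
    by_contra! hno
    have hdec : ∀ k ≤ M, 0 < k →
        maxFun g Y (x k) < maxFun g Y (x 0) - k * (3 * tildeEps L ε / 4) := by
      intro k
      induction k with
      | zero => intro _ h; exact absurd h (lt_irrefl _)
      | succ k ih =>
        intro hk _
        have h1 := maxFun_lt_of_not_shouldStop hL (hno k hk)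
        rcases Nat.eq_zero_or_pos k with rfl | hk0
        · simpa using h1
        · have h2 := ih (by omega) hk0
          push_cast
          linarith
    linarith [hdec M le_rfl hM1, hf (x M)]
  have hleast : ∀ j < Nat.find hex, ¬ ShouldStop g Y L ε (x j) (x (j + 1)) := fun j hj hterm =>
    Nat.find_min hex hj ⟨hj.trans (Nat.find_spec hex).1, hterm⟩
  exact ⟨Nat.find hex, (Nat.find_spec hex).1, hleast, (Nat.find_spec hex).2,
    hg.isFOSP_of_shouldStop hL hf hε (hx _ hleast) (Nat.find_spec hex).2⟩

theorem innerSolve_accurate (hL : 0 < L) {ε : ℝ} (hε : 0 < ε) {fstar : ℝ}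
    (hf : ∀ x, fstar ≤ maxFun g Y x) (hD : 0 < Metric.diam Y) {y₀ : F} (hy₀ : y₀ ∈ Y) (c : E) :
    (∃ x' n, innerSolve g G Y L ε y₀ c x' n) ∧
      ∀ x' n, innerSolve g G Y L ε y₀ c x' n → InnerAccurate g Y L ε c x' := by
  set N := ⌈Real.sqrt (6 * (3 * L) ^ 2 * Metric.diam Y ^ 2 / (L * (tildeEps L ε / 4)))⌉₊
  set Γ := L * Metric.diam Y + Real.sqrt (2 * L * (maxFun g Y c - fstar))
  obtain ⟨T, hT⟩ := pow_unbounded_of_one_lt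
    (200 * Γ ^ 2 * (N : ℝ) ^ 4 / (9 * L ^ 2 * Metric.diam Y ^ 2)) one_lt_two
  rw [div_lt_iff₀ (by positivity)] at hT
  obtain ⟨h1, h2⟩ := hg.innerSolve_spec hL hε hD hy₀ c (fun v hv => hg.norm_fst_le hL hf c hv)
    (N := N) rfl hT.le
  exact ⟨h1, fun x' n h => (h2 x' n h).1⟩

/-- Prox-DIAG with DIAG as the inner solver; here `B` bounds the oracle calls of one inner solve. -/
theorem proxDiag_spec (hL : 0 < L) {ε : ℝ} (hε : 0 < ε) {fstar : ℝ}
    (hf : ∀ x, fstar ≤ maxFun g Y x) (hD : 0 < Metric.diam Y) {y₀ : F} (hy₀ : y₀ ∈ Y) (x₀ : E) :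
    (∃ x k n, proxDiag g G Y L ε x₀ y₀ (x, k) n) ∧
    ∀ x k n, proxDiag g G Y L ε x₀ y₀ (x, k) n →
      (k + 1 ≤ max (outerSteps L ε (maxFun g Y x₀ - fstar)) 1 ∧ IsFOSP (maxFun g Y) L ε x) ∧
      ∀ B, (∀ c, maxFun g Y c ≤ maxFun g Y x₀ → ∀ x' m, innerSolve g G Y L ε y₀ c x' m → m ≤ B) →
        n ≤ max (outerSteps L ε (maxFun g Y x₀ - fstar)) 1 * B := by
  have hM := le_outerSteps_mul (gap := maxFun g Y x₀ - fstar) hL hε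
  set M := max (outerSteps L ε (maxFun g Y x₀ - fstar)) 1 with hMdef
  have hM1 : 1 ≤ M := le_max_right _ _
  have he : 0 < 3 * tildeEps L ε / 4 := by unfold tildeEps; positivity
  set e := 3 * tildeEps L ε / 4 with hedef
  let P : ℕ → E × ℕ → Prop := fun T s =>
    T + s.2 = M ∧ 1 ≤ T ∧ maxFun g Y s.1 ≤ maxFun g Y x₀ - s.2 * e
  have hP : P M (x₀, 0) := ⟨by simp, hM1, by simp⟩
  have hnext : ∀ T s x', P T s → ¬ ShouldStop g Y L ε s.1 x' →
      P (T - 1) (x', s.2 + 1) ∧ 2 ≤ T := by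
    rintro T s x' ⟨h1, h2, h3⟩ hterm
    have h4 := maxFun_lt_of_not_shouldStop hL hterm
    have h5 : maxFun g Y x' < maxFun g Y x₀ - (s.2 + 1 : ℕ) * e := by push_cast; linarith
    have h6 : 2 ≤ T := by
      by_contra hlt
      rw [show s.2 + 1 = M by omega] at h5
      linarith [hf x']
    refine ⟨⟨?_, ?_, h5.le⟩, h6⟩
    · simp only []; omega
    · omega
  constructor
  · obtain ⟨b, n, hb⟩ := Comp.exists_loop (P := P) (body := fun s : E × ℕ =>
      (innerSolve g G Y L ε y₀ s.1).bind fun x' =>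
        @ite _ (ShouldStop g Y L ε s.1 x') (Classical.propDecidable _)
          (Comp.ret (Sum.inr s)) (Comp.ret (Sum.inl (x', s.2 + 1)))) (by
        intro T s hs
        obtain ⟨x', m, hx'⟩ := (hg.innerSolve_accurate hL hε hf hD hy₀ s.1).1
        by_cases hterm : ShouldStop g Y L ε s.1 x'
        · exact .inl ⟨s, m + 0, x', m, 0, hx', by
            beta_reduce; rw [if_pos hterm]; exact ⟨rfl, rfl⟩, rfl⟩
        · obtain ⟨h1, h2⟩ := hnext T s x' hs hterm
          exact .inr ⟨_, m + 0, T - 1, by omega,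
            ⟨x', m, 0, hx', by beta_reduce; rw [if_neg hterm]; exact ⟨rfl, rfl⟩, rfl⟩, h1⟩) hP
    exact ⟨b.1, b.2, n, hb⟩
  · intro x k n hn
    refine Comp.Loop.of_invariant (P := P) (Q := fun T (b : E × ℕ) n =>
      (b.2 + 1 ≤ M ∧ IsFOSP (maxFun g Y) L ε b.1) ∧ ∀ B, (∀ c, maxFun g Y c ≤ maxFun g Y x₀ →
        ∀ x' m, innerSolve g G Y L ε y₀ c x' m → m ≤ B) → n ≤ T * B) ?_ ?_ hn hP
    · rintro T s b m ⟨h1, h2, h3⟩ ⟨x', m₁, m₂, hx', hb, rfl⟩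
      split_ifs at hb with hterm
      · obtain ⟨hb, rfl⟩ := hb
        obtain rfl := Sum.inr_injective hb
        have h4 := (hg.innerSolve_accurate hL hε hf hD hy₀ b.1).2 x' m₁ hx'
        refine ⟨⟨by omega, hg.isFOSP_of_shouldStop hL hf hε h4 hterm⟩, fun B hB => ?_⟩
        have h5 : 0 ≤ b.2 * e := by positivity
        exact (hB b.1 (by linarith) x' m₁ hx').trans (Nat.le_mul_of_pos_left B h2)
      · obtain ⟨hb, -⟩ := hb
        cases hb
    · rintro T s s' m hs ⟨x', m₁, m₂, hx', hb, rfl⟩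
      split_ifs at hb with hterm
      · obtain ⟨hb, -⟩ := hb
        cases hb
      · obtain ⟨hb, rfl⟩ := hb
        obtain rfl := Sum.inl_injective hb
        obtain ⟨h1, h2⟩ := hnext T s x' hs hterm
        refine ⟨T - 1, h1, fun b n ⟨h3, h4⟩ => ⟨h3, fun B hB => ?_⟩⟩
        have h5 : 0 ≤ s.2 * e := by positivity
        have h6 := hB s.1 (by linarith [hs.2.2]) x' m₁ hx'
        calc m₁ + 0 + n ≤ B + (T - 1) * B := add_le_add h6 (h4 B hB)
          _ = (T - 1 + 1) * B := by ring
          _ = T * B := by rw [Nat.sub_add_cancel (by omega)]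

end IsNonconvexConcave

/-- The explicit bound on the number of oracle calls, for small `ε`. -/
theorem exists_forall_oracle_bound {L D Δ : ℝ} (hL : 0 < L) (hD : 0 < D) (hΔ : 0 < Δ) :
    ∃ ε₀ : ℝ, 0 < ε₀ ∧ ∀ ε : ℝ, 0 < ε → ε ≤ ε₀ → ∀ N : ℕ,
      N = ⌈Real.sqrt (6 * (3 * L) ^ 2 * D ^ 2 / (L * (tildeEps L ε / 4)))⌉₊ → ∃ T : ℕ,
        200 * (L * D + Real.sqrt (2 * L * Δ)) ^ 2 * N ^ 4 ≤ 2 ^ T * (9 * L ^ 2 * D ^ 2) ∧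
        ((max (outerSteps L ε Δ) 1 *
          (N * ((⌈Real.logb 2 (10 * (N : ℝ) ^ 2)⌉₊ + 1) * (T + 1) + 1)) : ℕ) : ℝ) ≤
          10 ^ 6 * (L ^ 2 * D * Δ / ε ^ 3 * Real.log (1 / ε) ^ 2) := by
  set Γ := L * D + Real.sqrt (2 * L * Δ) with hΓ
  have hΓ0 : 0 < Γ := by positivity
  set c₁ := 10 * 119 ^ 2 * (L * D) ^ 2 with hc₁
  set c₂ := 200 * Γ ^ 2 * (119 * (L * D)) ^ 4 / (9 * L ^ 2 * D ^ 2) with hc₂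
  have hc₁0 : 0 < c₁ := by positivity
  have hc₂0 : 0 < c₂ := by positivity
  refine ⟨min (min (L * D) (1 / c₁)) (min (1 / c₂) (min (Real.sqrt (L * Δ)) (1 / 2))),
    by positivity, fun ε hε hε₀ N hN => ?_⟩
  simp only [le_min_iff] at hε₀
  obtain ⟨⟨h1, h2⟩, h3, h4, h5⟩ := hε₀
  have hN0 : 0 < N := by rw [hN, Nat.ceil_pos]; unfold tildeEps; positivity
  have hN1 : (N : ℝ) ≤ 119 * (L * D) / ε := by
    have e1 : Real.sqrt (6 * (3 * L) ^ 2 * D ^ 2 / (L * (tildeEps L ε / 4)))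
        ≤ 118 * (L * D / ε) := by
      refine Real.sqrt_le_iff.2 ⟨by positivity, ?_⟩
      have : 6 * (3 * L) ^ 2 * D ^ 2 / (L * (tildeEps L ε / 4)) = 13824 * ((L * D) / ε) ^ 2 := by
        unfold tildeEps; field_simp; norm_num
      rw [this, mul_pow]
      gcongr; norm_num
    have e2 := (Nat.ceil_lt_add_one (Real.sqrt_nonneg
      (6 * (3 * L) ^ 2 * D ^ 2 / (L * (tildeEps L ε / 4))))).le
    rw [← hN] at e2
    have e3 : 1 ≤ L * D / ε := (one_le_div hε).2 h1
    rw [mul_div_assoc]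
    linarith
  set l := Real.logb 2 (1 / ε) with hl
  have hl1 : 1 ≤ l := by
    rw [hl, Real.le_logb_iff_rpow_le one_lt_two (by positivity), Real.rpow_one,
      le_div_iff₀ hε]
    linarith
  have hpow : ∀ (k : ℕ) (a : ℝ), 0 < a → a ≤ (1 / ε) ^ k →
      (⌈Real.logb 2 a⌉₊ : ℝ) ≤ k * l + 1 := by
    intro k a ha hak
    have e1 : Real.logb 2 a ≤ k * l := by
      rw [hl, ← Real.logb_pow]
      exact Real.logb_le_logb_of_le one_lt_two ha hak
    exact (Nat.ceil_le_ceil e1 |> Nat.cast_le.2).trans (Nat.ceil_lt_add_one (by positivity)).le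
  have hN' : (0 : ℝ) < N := Nat.cast_pos.2 hN0
  have hR := hpow 3 (10 * (N : ℝ) ^ 2) (by positivity) (by
    calc 10 * (N : ℝ) ^ 2 ≤ 10 * (119 * (L * D) / ε) ^ 2 := by gcongr
      _ = c₁ * (1 / ε) ^ 2 := by rw [hc₁]; ring
      _ ≤ 1 / ε * (1 / ε) ^ 2 := by gcongr; exact (le_one_div hε hc₁0).1 h2
      _ = _ := by ring)
  have hT := hpow 5 (200 * Γ ^ 2 * N ^ 4 / (9 * L ^ 2 * D ^ 2)) (by positivity) (by
    calc 200 * Γ ^ 2 * N ^ 4 / (9 * L ^ 2 * D ^ 2)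
        ≤ 200 * Γ ^ 2 * (119 * (L * D) / ε) ^ 4 / (9 * L ^ 2 * D ^ 2) := by gcongr
      _ = c₂ * (1 / ε) ^ 4 := by rw [hc₂]; ring
      _ ≤ 1 / ε * (1 / ε) ^ 4 := by gcongr; exact (le_one_div hε hc₂0).1 h3
      _ = _ := by ring)
  refine ⟨⌈Real.logb 2 (200 * Γ ^ 2 * N ^ 4 / (9 * L ^ 2 * D ^ 2))⌉₊, ?_, ?_⟩
  · have e1 := Nat.le_ceil (Real.logb 2 (200 * Γ ^ 2 * N ^ 4 / (9 * L ^ 2 * D ^ 2)))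
    rwa [Real.logb_le_iff_le_rpow one_lt_two (by positivity), Real.rpow_natCast,
      div_le_iff₀ (by positivity)] at e1
  · have hK : ((max (outerSteps L ε Δ) 1 : ℕ) : ℝ) ≤ 87 * (L * Δ) / ε ^ 2 := by
      have e1 : 1 ≤ L * Δ / ε ^ 2 := by
        rw [one_le_div (by positivity)]; exact (Real.le_sqrt' hε).1 h4
      have e2 : (outerSteps L ε Δ : ℝ) ≤ 4 ^ 4 * L * Δ / (3 * ε ^ 2) + 1 :=
        (Nat.ceil_lt_add_one (by positivity)).le
      have e3 : 4 ^ 4 * L * Δ / (3 * ε ^ 2) = 256 / 3 * (L * Δ / ε ^ 2) := by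
        field_simp; norm_num
      rw [mul_div_assoc]
      push_cast
      refine max_le ?_ ?_ <;> linarith
    push_cast at hR hT hK ⊢
    have hlog : l ^ 2 ≤ 2.2 * Real.log (1 / ε) ^ 2 := by
      have e1 : l * Real.log 2 = Real.log (1 / ε) := by
        rw [hl, Real.logb]; field_simp
      rw [← e1, mul_pow]
      have e2 : (0.69 : ℝ) ^ 2 ≤ Real.log 2 ^ 2 := by
        gcongr; linarith [Real.log_two_gt_d9]
      nlinarith [sq_nonneg l]
    calc _ ≤ 87 * (L * Δ) / ε ^ 2 * (119 * (L * D) / ε *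
          ((3 * l + 1 + 1) * (5 * l + 1 + 1) + 1)) := by gcongr
      _ ≤ 87 * (L * Δ) / ε ^ 2 * (119 * (L * D) / ε * (36 * l ^ 2)) := by
        gcongr; nlinarith
      _ ≤ 87 * (L * Δ) / ε ^ 2 * (119 * (L * D) / ε * (36 * (2.2 * Real.log (1 / ε) ^ 2))) := by
        gcongr
      _ = (87 * 119 * 36 * 2.2) * (L ^ 2 * D * Δ / ε ^ 3 * Real.log (1 / ε) ^ 2) := by
        field_simp
      _ ≤ _ := by
        gcongr; norm_num

end Minimax

theorem theorem2 :
    -- convergence in at most `max K 1` outer iterations, for every accuracy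
    (∀ (p q : ℕ)
      (g : EuclideanSpace ℝ (Fin p) → EuclideanSpace ℝ (Fin q) → ℝ)
      (G : EuclideanSpace ℝ (Fin p) → EuclideanSpace ℝ (Fin q) →
        EuclideanSpace ℝ (Fin p) × EuclideanSpace ℝ (Fin q))
      (Y : Set (EuclideanSpace ℝ (Fin q))) (L fstar ε : ℝ)
      (x₀ : EuclideanSpace ℝ (Fin p)) (y₀ : EuclideanSpace ℝ (Fin q)),
      0 < L → 0 < ε → IsNonconvexConcave g G Y L → (∀ x, fstar ≤ maxFun g Y x) → y₀ ∈ Y →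
      -- whatever sufficiently accurate inner solutions are used until the method stops
      (∀ x : ℕ → EuclideanSpace ℝ (Fin p), x 0 = x₀ →
        (∀ k, (∀ j < k, ¬ ShouldStop g Y L ε (x j) (x (j + 1))) →
          InnerAccurate g Y L ε (x k) (x (k + 1))) →
        ∃ k, k + 1 ≤ max (outerSteps L ε (maxFun g Y x₀ - fstar)) 1 ∧
          (∀ j < k, ¬ ShouldStop g Y L ε (x j) (x (j + 1))) ∧
          ShouldStop g Y L ε (x k) (x (k + 1)) ∧
          IsFOSP (maxFun g Y) L ε (x k)) ∧
      -- with DIAG as the inner solver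
      (0 < Metric.diam Y →
        (∀ c, (∃ x' n, innerSolve g G Y L ε y₀ c x' n) ∧
          ∀ x' n, innerSolve g G Y L ε y₀ c x' n → InnerAccurate g Y L ε c x') ∧
        (∃ x k n, proxDiag g G Y L ε x₀ y₀ (x, k) n) ∧
        ∀ x k n, proxDiag g G Y L ε x₀ y₀ (x, k) n →
          k + 1 ≤ max (outerSteps L ε (maxFun g Y x₀ - fstar)) 1 ∧
          IsFOSP (maxFun g Y) L ε x)) ∧
    -- the total number of first-order oracle calls, with an absolute constant
    (∃ C : ℝ, 0 < C ∧ ∀ L D Δ : ℝ, 0 < L → 0 < D → 0 < Δ → ∃ ε₀ : ℝ, 0 < ε₀ ∧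
      ∀ (p q : ℕ)
        (g : EuclideanSpace ℝ (Fin p) → EuclideanSpace ℝ (Fin q) → ℝ)
        (G : EuclideanSpace ℝ (Fin p) → EuclideanSpace ℝ (Fin q) →
          EuclideanSpace ℝ (Fin p) × EuclideanSpace ℝ (Fin q))
        (Y : Set (EuclideanSpace ℝ (Fin q))) (fstar ε : ℝ)
        (x₀ : EuclideanSpace ℝ (Fin p)) (y₀ : EuclideanSpace ℝ (Fin q)),
        IsNonconvexConcave g G Y L → (∀ x, fstar ≤ maxFun g Y x) → y₀ ∈ Y →
        Metric.diam Y = D → maxFun g Y x₀ - fstar = Δ → 0 < ε → ε ≤ ε₀ →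
        ∀ x k n, proxDiag g G Y L ε x₀ y₀ (x, k) n →
          (n : ℝ) ≤ C * (L ^ 2 * D * Δ / ε ^ 3 * Real.log (1 / ε) ^ 2)) := by
  refine ⟨?_, 10 ^ 6, by norm_num, ?_⟩
  · intro p q g G Y L fstar ε x₀ y₀ hL hε hg hf hy₀
    refine ⟨?_, fun hD => ⟨fun c => hg.innerSolve_accurate hL hε hf hD hy₀ c, ?_⟩⟩
    · rintro x rfl hx
      exact hg.exists_shouldStop hL hε hf hx
    · obtain ⟨h1, h2⟩ := hg.proxDiag_spec hL hε hf hD hy₀ x₀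
      exact ⟨h1, fun x k n h => (h2 x k n h).1⟩
  · intro L D Δ hL hD hΔ
    obtain ⟨ε₀, hε₀, hbound⟩ := exists_forall_oracle_bound hL hD hΔ
    refine ⟨ε₀, hε₀, ?_⟩
    rintro p q g G Y fstar ε x₀ y₀ hg hf hy₀ rfl rfl hε hle x k n hn
    obtain ⟨T, hT, hcount⟩ := hbound ε hε hle _ rfl
    refine le_trans (Nat.cast_le.2 ?_) hcount
    refine ((hg.proxDiag_spec hL hε hf hD hy₀ x₀).2 x k n hn).2 _ fun c hc x' m hm => ?_
    refine ((hg.innerSolve_spec hL hε hD hy₀ c (fun v hv => (hg.norm_fst_le hL hf c hv).trans ?_)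
      rfl hT).2 x' m hm).2
    gcongr
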